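/- All bornologies are convex bornologies on complex vector spaces. A DFN-space is a bornological vector space that is the inductive limit of a sequence of Banach spaces with injective nuclear transition maps (its bounded sets are the images of the bounded sets of these Banach spaces). A DFN-field $A$ is a field that is also a $\mathbb{C}$-algebra and a DFN-space, with bounded multiplication. Let $\mathrm{Mod}(A)$ be the category of $A$-vector spaces, and $\mathrm{Mod}^{\mathrm{dfn}}(A)$ the category of DFN-spaces $E$ with an $A$-module structure whose action $A\times E\to E$ is bounded, the morphisms being the bounded $A$-linear maps. For $E$ in $\mathrm{Mod}^{\mathrm{dfn}}(A)$, let $E^\vee$ be the $A$-module of bounded $A$-linear maps $E\to A$. A bounded $A$-linear map $u\colon E\to F$ is $A$-nuclear if there are a summable sequence $\lambda_n\ge 0$, a bounded sequence $y_n$ in $F$ and a bounded sequence $u_n$ of elements of $E^\vee$ (i.e. $\bigcup_n u_n(B)$ is bounded in $A$ for every bounded $B\subset E$) such that $u(x)=\sum_n\lambda_n u_n(x)y_n$ for all $x\in E$. **Theorem 4.6.** Let $A$ be a DFN-field, let $a\le b$ be integers, and let $\{E^\bullet_n,u^\bullet_n\}_{n\in\mathbb{N}}$ be an inductive system of complexes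 in $\mathrm{Mod}^{\mathrm{dfn}}(A)$ concentrated in degrees $[a,b]$. Set $F^\bullet_n=(E^\bullet_n)^\vee$. Assume: (i) for all $i\in\mathbb{Z}$ and $n\in\mathbb{N}$, the map $u^i_n\colon E^i_n\to E^i_{n+1}$ is $A$-nuclear; (ii) for all $i\in\mathbb{Z}$, the ind-object $\text{“}\varinjlim_n\text{”}\,H^i(E^\bullet_n)$ of $\mathrm{Mod}(A)$ is isomorphic to a finite-dimensional $A$-vector space (the cohomology being computed in $\mathrm{Mod}(A)$). Then the inclusions $F^\bullet_n\subset\mathrm{Hom}_A(E^\bullet_n,A)$ induce an isomorphism $$\text{“}\varprojlim_n\text{”}\,F^\bullet_n\;\simeq\;\text{“}\varprojlim_n\text{”}\,\mathrm{Hom}_A(E^\bullet_n,A)\quad\text{in } \mathrm{Pro}(K^b(\mathrm{Mod}(A))),$$ where $K^b$ denotes the homotopy category of bounded complexes. In particular, for each $i\in\mathbb{Z}$, the pro-object $\text{“}\varprojlim_n\text{”}\,H^{-i}(F^\bullet_n)$ of $\mathrm{Mod}(A)$ is isomorphic to a finite-dimensional $A$-vector space and is dual to $\text{“}\varinjlim_n\text{”}\,H^i(E^\bullet_n)$,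 the duality being induced by the evaluation of linear forms on cocycles. -/

import Mathlib

open CategoryTheory Opposite Bornology Filter Topology
open scoped Pointwise

universe u v w

noncomputable section

/-! ## Convex bornological spaces, algebras and modules -/

/-- A bornology on a complex vector space is a *convex (vector) bornology* if addition and scalar
multiplication are bounded and convex hulls of bounded sets are bounded. Together with
`Bornology E` this makes `E` into a bc-space. -/
class ConvexBornology (E : Type*) [AddCommGroup E] [Module ℂ E] [Bornology E] : Prop
    extends BoundedAdd E where
  isBounded_smul : ∀ {s : Set ℂ} {t : Set E}, IsBounded s → IsBounded t → IsBounded (s • t)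
  isBounded_convexHull : ∀ {t : Set E}, IsBounded t → IsBounded (convexHull ℝ t)

/-- A bornological module over a bornological algebra `A`: the action `A × E → E` is bounded. -/
class BornologicalModule (A E : Type*) [Bornology A] [Bornology E] [SMul A E] : Prop where
  isBounded_smul : ∀ {s : Set A} {t : Set E}, IsBounded s → IsBounded t → IsBounded (s • t)

/-- A map is bounded if it sends bounded sets to bounded sets. -/
def IsBoundedMap {E F : Type*} [Bornology E] [Bornology F] (f : E → F) : Prop :=
  ∀ ⦃s : Set E⦄, IsBounded s → IsBounded (f '' s)

/-- Convergence of a sequence in a bc-space: for some convex circled bounded set `B`, the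
sequence `‖s n - x‖_B` tends to zero. -/
def BornTendsto {F : Type*} [AddCommGroup F] [Module ℂ F] [Bornology F]
    (s : ℕ → F) (x : F) : Prop :=
  ∃ B : Set F, IsBounded B ∧ Convex ℝ B ∧ Balanced ℂ B ∧
    ∃ ε : ℕ → ℝ, Tendsto ε atTop (𝓝 0) ∧ ∀ n, s n - x ∈ ε n • B

/-- `A`-nuclear maps: `f x = ∑ λₙ uₙ(x) yₙ` with `(λₙ)` a summable sequence of nonnegative reals,
`(uₙ)` a bounded sequence of bounded `A`-linear forms and `(yₙ)` a bounded sequence. -/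
def IsNuclear (A : Type*) [CommRing A] [Bornology A]
    {E F : Type*} [AddCommGroup E] [Module A E] [Bornology E]
    [AddCommGroup F] [Module ℂ F] [Module A F] [Bornology F] (f : E →ₗ[A] F) : Prop :=
  ∃ (lam : ℕ → ℝ) (u : ℕ → E →ₗ[A] A) (y : ℕ → F),
    (∀ n, 0 ≤ lam n) ∧ Summable lam ∧
    (∀ n, IsBoundedMap (u n)) ∧ (∀ s : Set E, IsBounded s → IsBounded (⋃ n, u n '' s)) ∧
    IsBounded (Set.range y) ∧
    ∀ x, BornTendsto (fun N => ∑ n ∈ Finset.range N, (lam n : ℂ) • u n x • y n) (f x)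

/-- A presentation of a bornological vector space `E` as the inductive limit of a sequence of
Banach spaces with injective `ℂ`-nuclear transition maps: a subset of `E` is bounded iff it is the
image of a bounded subset of one of the Banach spaces. -/
structure DFNPresentation (E : Type u) [AddCommGroup E] [Module ℂ E] [Bornology E] where
  space : ℕ → Type u
  [normedAddCommGroup : ∀ n, NormedAddCommGroup (space n)]
  [normedSpace : ∀ n, NormedSpace ℂ (space n)]
  [completeSpace : ∀ n, CompleteSpace (space n)]
  transition : ∀ n, space n →L[ℂ] space (n + 1)
  transition_injective : ∀ n, Function.Injective (transition n)
  transition_nuclear : ∀ n, IsNuclear ℂ (transition n : space n →ₗ[ℂ] space (n + 1))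
  incl : ∀ n, space n →ₗ[ℂ] E
  incl_injective : ∀ n, Function.Injective (incl n)
  incl_transition : ∀ n x, incl (n + 1) (transition n x) = incl n x
  incl_surjective : ∀ x : E, ∃ n y, incl n y = x
  isBounded_iff : ∀ s : Set E, IsBounded s ↔ ∃ n, ∃ t : Set (space n), IsBounded t ∧ incl n '' t = s

/-- A bornological vector space is a DFN-space if it has a presentation as above. -/
def IsDFNSpace (E : Type u) [AddCommGroup E] [Module ℂ E] [Bornology E] : Prop :=
  Nonempty (DFNPresentation E)

/-- A (commutative, unital) DFN-algebra: a bc-algebra whose underlying space is a DFN-space.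
A DFN-field is a field which is a DFN-algebra. -/
class DFNAlgebra (A : Type u) [CommRing A] [Algebra ℂ A] [Bornology A] : Prop
    extends ConvexBornology A, BoundedMul A where
  isDFNSpace : IsDFNSpace A

section BoundedHom

variable (A : Type*) [CommRing A] [Bornology A]
  (E F : Type*) [AddCommGroup E] [Module A E] [Bornology E]
  [AddCommGroup F] [Module A F] [Bornology F]

/-- The `A`-module of bounded `A`-linear maps `E → F`. -/
def boundedHom [BoundedAdd F] [BornologicalModule A F] : Submodule A (E →ₗ[A] F) where
  carrier := {f | IsBoundedMap f}
  zero_mem' := fun s _ => (isBounded_singleton (x := (0 : F))).subset (by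
    rintro _ ⟨x, _, rfl⟩; simp)
  add_mem' := fun {f g} hf hg s hs => (isBounded_add (hf hs) (hg hs)).subset (by
    rintro _ ⟨x, hx, rfl⟩
    exact Set.add_mem_add ⟨x, hx, rfl⟩ ⟨x, hx, rfl⟩)
  smul_mem' := fun c f hf s hs =>
    (BornologicalModule.isBounded_smul (isBounded_singleton (x := c)) (hf hs)).subset (by
      rintro _ ⟨x, hx, rfl⟩
      exact Set.smul_mem_smul rfl ⟨x, hx, rfl⟩)

end BoundedHom

instance (A : Type*) [CommRing A] [Bornology A] [BoundedMul A] : BornologicalModule A A where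
  isBounded_smul := fun hs ht => isBounded_mul hs ht

/-! ## The category of DFN `A`-modules -/

/-- Objects of `Mod^dfn(A)`: bornological `A`-modules which are DFN-spaces. -/
structure DFNModuleCat (A : Type u) [CommRing A] [Algebra ℂ A] [Bornology A] where
  carrier : Type u
  [addCommGroup : AddCommGroup carrier]
  [complexModule : Module ℂ carrier]
  [module : Module A carrier]
  [isScalarTower : IsScalarTower ℂ A carrier]
  [bornology : Bornology carrier]
  [convexBornology : ConvexBornology carrier]
  [bornologicalModule : BornologicalModule A carrier]
  isDFNSpace : IsDFNSpace carrier

namespace DFNModuleCat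

attribute [instance] addCommGroup complexModule module isScalarTower bornology convexBornology
  bornologicalModule

variable (A : Type u) [CommRing A] [Algebra ℂ A] [Bornology A]

instance : CoeSort (DFNModuleCat.{u} A) (Type u) := ⟨carrier⟩

/-- Morphisms are bounded `A`-linear maps. -/
instance : Category (DFNModuleCat.{u} A) where
  Hom E F := boundedHom A E F
  id E := ⟨LinearMap.id, fun s hs => by simpa using hs⟩
  comp f g := ⟨g.1.comp f.1, fun s hs => by
    have := g.2 (f.2 hs)
    rw [← Set.image_comp] at this
    exact this⟩

variable {A}

/-- The `A`-linear map underlying a morphism. -/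
def Hom.lin {E F : DFNModuleCat.{u} A} (f : E ⟶ F) : E →ₗ[A] F :=
  Subtype.val (p := fun g => g ∈ boundedHom A E F) f

lemma Hom.lin_bounded {E F : DFNModuleCat.{u} A} (f : E ⟶ F) : IsBoundedMap (Hom.lin f) :=
  Subtype.property (p := fun g => g ∈ boundedHom A E F) f

lemma Hom.ext_lin {E F : DFNModuleCat.{u} A} {f g : E ⟶ F} (h : Hom.lin f = Hom.lin g) : f = g :=
  Subtype.ext h

@[simp] lemma lin_id (E : DFNModuleCat.{u} A) : Hom.lin (𝟙 E) = LinearMap.id := rfl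

@[simp] lemma lin_comp {E F G : DFNModuleCat.{u} A} (f : E ⟶ F) (g : F ⟶ G) :
    Hom.lin (f ≫ g) = (Hom.lin g).comp (Hom.lin f) := rfl

instance (E F : DFNModuleCat.{u} A) : AddCommGroup (E ⟶ F) :=
  inferInstanceAs (AddCommGroup (boundedHom A E F))

@[simp] lemma lin_add {E F : DFNModuleCat.{u} A} (f g : E ⟶ F) :
    Hom.lin (f + g) = Hom.lin f + Hom.lin g := rfl

instance : Preadditive (DFNModuleCat.{u} A) where
  add_comp E F G f g h := Hom.ext_lin (by simp [LinearMap.comp_add])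
  comp_add E F G f g h := Hom.ext_lin (by simp [LinearMap.add_comp])

variable (A)

/-- The functor forgetting the bornology. -/
def forgetBornology : DFNModuleCat.{u} A ⥤ ModuleCat.{u} A where
  obj E := ModuleCat.of A E
  map f := ModuleCat.ofHom (Hom.lin f)

instance : (forgetBornology A).Additive where
  map_add := rfl

end DFNModuleCat

/-! ## Algebraic and bornological duals -/

section Duals

variable (A : Type u) [CommRing A]

/-- The functor `Hom_A(-, A)` on `A`-modules. -/
def moduleDual : (ModuleCat.{u} A)ᵒᵖ ⥤ ModuleCat.{u} A where
  obj M := ModuleCat.of A (Module.Dual A M.unop)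
  map f := ModuleCat.ofHom (Module.Dual.transpose f.unop.hom)

instance : (moduleDual A).Additive where
  map_add := by
    intro X Y f g
    ext φ
    exact LinearMap.ext fun x => φ.map_add _ _

variable [Algebra ℂ A] [Bornology A]

/-- The algebraic dual `E ↦ Hom_A(E, A)` on DFN `A`-modules. -/
abbrev algebraicDual : (DFNModuleCat.{u} A)ᵒᵖ ⥤ ModuleCat.{u} A :=
  (DFNModuleCat.forgetBornology A).op ⋙ moduleDual A

variable [DFNAlgebra A]

/-- The bornological dual `E ↦ E^∨`, the module of bounded `A`-linear maps `E → A`. -/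
def bornologicalDual : (DFNModuleCat.{u} A)ᵒᵖ ⥤ ModuleCat.{u} A where
  obj E := ModuleCat.of A (boundedHom A E.unop A)
  map {E F} f := ModuleCat.ofHom
    (((Module.Dual.transpose (DFNModuleCat.Hom.lin f.unop)).comp
      (boundedHom A E.unop A).subtype).codRestrict (boundedHom A F.unop A) fun φ s hs => by
        have := φ.2 (DFNModuleCat.Hom.lin_bounded f.unop hs)
        rw [← Set.image_comp] at this
        exact this)

instance : (bornologicalDual A).Additive where
  map_add := by
    intro X Y f g
    ext φ
    refine Subtype.ext (LinearMap.ext fun x => ?_)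
    exact φ.1.map_add (DFNModuleCat.Hom.lin f.unop x) (DFNModuleCat.Hom.lin g.unop x)

/-- The inclusion `E^∨ ⊆ Hom_A(E, A)`. -/
def dualInclusion : bornologicalDual A ⟶ algebraicDual A where
  app E := ModuleCat.ofHom (boundedHom A E.unop A).subtype

end Duals

/-! ## Complexes -/

section Complexes

variable (C : Type v) [Category.{w} C] [Preadditive C]

/-- `C^{[a,b]}(C)`: complexes concentrated in degrees in `[a, b]`. -/
abbrev IntervalComplex (a b : ℤ) :=
  ObjectProperty.FullSubcategory
    (fun K : CochainComplex C ℤ => K.IsStrictlyGE a ∧ K.IsStrictlyLE b)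

/-- `K^b(C)`: the homotopy category of bounded complexes. -/
abbrev BoundedHomotopyCategory :=
  ObjectProperty.FullSubcategory
    (fun K : HomotopyCategory C (ComplexShape.up ℤ) =>
      ∃ a b : ℤ, CochainComplex.IsStrictlyGE K.as a ∧ CochainComplex.IsStrictlyLE K.as b)

variable {C} {D : Type*} [Category* D] [Preadditive D]

/-- A contravariant functor `T`, applied to cochain complexes: `(T K)^i = T (K^{-i})`, with the
differentials of `K` transported by `T`. -/
def dualComplex (T : Cᵒᵖ ⥤ D) [T.PreservesZeroMorphisms] :
    (CochainComplex C ℤ)ᵒᵖ ⥤ CochainComplex D ℤ :=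
  (CochainComplex.opEquivalence C).functor ⋙ T.mapHomologicalComplex (ComplexShape.up ℤ)

lemma dualComplex_bounded (T : Cᵒᵖ ⥤ D) [T.PreservesZeroMorphisms] {a b : ℤ}
    (K : CochainComplex C ℤ) (ha : K.IsStrictlyGE a) (hb : K.IsStrictlyLE b) :
    ((dualComplex T).obj (op K)).IsStrictlyGE (-b) ∧
      ((dualComplex T).obj (op K)).IsStrictlyLE (-a) := by
  refine ⟨(CochainComplex.isStrictlyGE_iff _ _).2 fun i hi => ?_,
    (CochainComplex.isStrictlyLE_iff _ _).2 fun i hi => ?_⟩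
  · exact T.map_isZero (K.isZero_of_isStrictlyLE b (-i) (by lia)).op
  · exact T.map_isZero (K.isZero_of_isStrictlyGE a (-i) (by lia)).op

/-- A contravariant functor as a functor from complexes in degrees `[a, b]` to the bounded
homotopy category. -/
def dualKb (T : Cᵒᵖ ⥤ D) [T.PreservesZeroMorphisms] (a b : ℤ) :
    (IntervalComplex C a b)ᵒᵖ ⥤ BoundedHomotopyCategory D :=
  ObjectProperty.lift _
    ((ObjectProperty.ι _).op ⋙ dualComplex T ⋙ HomotopyCategory.quotient D (ComplexShape.up ℤ))
    (fun K => ⟨-b, -a, dualComplex_bounded T K.unop.obj K.unop.property.1 K.unop.property.2⟩)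

/-- A natural transformation, applied in each degree. -/
def dualKbMap {T T' : Cᵒᵖ ⥤ D} [T.PreservesZeroMorphisms] [T'.PreservesZeroMorphisms]
    (α : T ⟶ T') (a b : ℤ) : dualKb T a b ⟶ dualKb T' a b where
  app K := ObjectProperty.homMk ((HomotopyCategory.quotient D (ComplexShape.up ℤ)).map
    ((NatTrans.mapHomologicalComplex α (ComplexShape.up ℤ)).app
      ((CochainComplex.opEquivalence C).functor.obj (op K.unop.obj))))
  naturality K L f := by
    apply ObjectProperty.hom_ext
    exact ((Functor.whiskerRight (NatTrans.mapHomologicalComplex α (ComplexShape.up ℤ))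
      (HomotopyCategory.quotient D (ComplexShape.up ℤ))).naturality
        ((CochainComplex.opEquivalence C).functor.map f.unop.hom.op))

end Complexes

/-! ## Ind-objects and pro-objects -/

section IndPro

variable (C : Type v) [Category.{w} C]

/-- The category of pro-objects of `C`. -/
abbrev Pro := (Ind Cᵒᵖ)ᵒᵖ

variable {C}

/-- The ind-object attached to an inductive system indexed by `ℕ`. -/
def indLim : (ℕ ⥤ C) ⥤ Ind C :=
  (Functor.whiskeringLeft _ _ _).obj (AsSmall.down.{0, 0, w} (C := ℕ)) ⋙ Ind.lim (AsSmall.{w, 0, 0} ℕ)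

/-- The pro-object attached to a projective system indexed by `ℕ`. -/
def proLim : (ℕᵒᵖ ⥤ C) ⥤ Pro C :=
  ((Functor.leftOpRightOpEquiv ℕ C).functor ⋙ indLim (C := Cᵒᵖ)).rightOp

/-- The embedding of `C` into its pro-objects. -/
def proConst : C ⥤ Pro C := (Ind.yoneda (C := Cᵒᵖ)).rightOp

instance : (proConst (C := C)).Full := inferInstanceAs (Functor.rightOp _).Full
instance : (proConst (C := C)).Faithful := inferInstanceAs (Functor.rightOp _).Faithful

/-- The canonical morphism from a term of an inductive system to its ind-object. -/
def indι (X : ℕ ⥤ C) (n : ℕ) : Ind.yoneda.obj (X.obj n) ⟶ indLim.obj X :=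
  Limits.colimit.ι ((AsSmall.down.{0, 0, w} (C := ℕ) ⋙ X) ⋙ Ind.yoneda) (AsSmall.up.obj n)

/-- The canonical morphism from the pro-object of a projective system to one of its terms. -/
def proπ (Y : ℕᵒᵖ ⥤ C) (n : ℕ) : proLim.obj Y ⟶ proConst.obj (Y.obj (op n)) :=
  (indι Y.rightOp n).op

/-- The components `X n ⟶ V` of a morphism from `"colim" X` to an object `V` of `C`. -/
def indComponent {X : ℕ ⥤ C} {V : C} (e : indLim.obj X ⟶ Ind.yoneda.obj V) (n : ℕ) :
    X.obj n ⟶ V :=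
  Ind.yoneda.preimage (indι X n ≫ e)

/-- The components `V ⟶ Y n` of a morphism from an object `V` of `C` to `"lim" Y`. -/
def proComponent {Y : ℕᵒᵖ ⥤ C} {V : C} (e : proConst.obj V ⟶ proLim.obj Y) (n : ℕ) :
    V ⟶ Y.obj (op n) :=
  proConst.preimage (e ≫ proπ Y n)

end IndPro

/-! ## Systems of complexes of DFN-modules -/

section Systems

variable {A : Type u} [CommRing A] [Algebra ℂ A] [Bornology A]

/-- The underlying complex of `A`-modules of a complex of DFN `A`-modules. -/
abbrev underlyingComplex :
    CochainComplex (DFNModuleCat.{u} A) ℤ ⥤ CochainComplex (ModuleCat.{u} A) ℤ :=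
  (DFNModuleCat.forgetBornology A).mapHomologicalComplex (ComplexShape.up ℤ)

variable {a b : ℤ} (E : ℕ ⥤ IntervalComplex (DFNModuleCat.{u} A) a b)

/-- The inductive system `n ↦ H^i(E_n)` of `A`-modules. -/
def cohomologySystem (i : ℤ) : ℕ ⥤ ModuleCat.{u} A :=
  E ⋙ ObjectProperty.ι _ ⋙ underlyingComplex ⋙
    HomologicalComplex.homologyFunctor (ModuleCat.{u} A) (ComplexShape.up ℤ) i

/-- The map `E_n^i → E_{n+1}^i` of the inductive system. -/
def transitionMap (n : ℕ) (i : ℤ) : (E.obj n).obj.X i →ₗ[A] (E.obj (n + 1)).obj.X i :=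
  DFNModuleCat.Hom.lin ((E.map (homOfLE n.le_succ)).hom.f i)

variable [DFNAlgebra A]

/-- The projective system `n ↦ H^i(E_n^∨)` of `A`-modules. -/
def dualCohomologySystem (i : ℤ) : ℕᵒᵖ ⥤ ModuleCat.{u} A :=
  (E ⋙ ObjectProperty.ι _).op ⋙ dualComplex (bornologicalDual A) ⋙
    HomologicalComplex.homologyFunctor (ModuleCat.{u} A) (ComplexShape.up ℤ) i

/-- The evaluation of a cocycle of degree `i` of `K^∨` on a cocycle of degree `-i` of `K`. -/
def evalCocycles (K : CochainComplex (DFNModuleCat.{u} A) ℤ) (i : ℤ)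
    (φ : ((dualComplex (bornologicalDual A)).obj (op K)).cycles i)
    (x : (underlyingComplex.obj K).cycles (-i)) : A :=
  (show boundedHom A (K.X (-i)) A from
      ((dualComplex (bornologicalDual A)).obj (op K)).iCycles i φ).1
    (show K.X (-i) from (underlyingComplex.obj K).iCycles (-i) x)

end Systems

end

/-!
The point is that the system of complexes is, up to *bounded* homotopies and raising the index, of
finite rank. More precisely (`exists_homotopy_hasBoundedForms`), for every `n` there are `m ≥ n` and
a morphism of complexes `P : E_n ⟶ E_m`, homotopic to the transition morphism in the category of
DFN-modules, whose components are `x ↦ ∑ j, ξ j x • w j` with finitely many bounded forms `ξ j`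
vanishing on coboundaries and finitely many cocycles `w j`. Composition with such a `P` turns an
arbitrary `A`-linear form into a bounded one. It thus gives a map `Hom_A(E_m, A) ⟶ E_n^∨` which is
inverse to the inclusions, up to homotopy and transition maps, and this is what an isomorphism of
pro-objects requires (`isIso_proLim_map`).

The homotopy is constructed by descending induction on the degree (`exists_partial_homotopy`).
When it is known in degrees `> j`, the remaining part `v` of the transition map in degree `j` takes
its values in cocycles. Composing it with a nuclear map `u x = ∑ λ_k u_k(x) y_k` gives the map
`v (u x) = ∑ λ_k u_k(x) v(y_k)`, where the `v(y_k)` form a bounded sequence of cocycles. As the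
ind-cohomology is finite-dimensional, the image of a cocycle at a later index is a coboundary plus a
combination of finitely many cocycles `w s` with independent classes. By a Baire category argument
(`exists_bounded_section`, `DFNModuleCat.exists_bounded_lift`), the coefficients and the primitive
can be chosen bounded when the cocycle runs through a bounded set; summing up, one gets the bounded
forms `ξ s` and the next component of the homotopy (`DFNModuleCat.exists_finite_rank_add_lift`). The
forms `ξ s` vanish on coboundaries by independence of the classes of the `w s`.

For the duality, evaluation of forms on cocycles defines a morphism from the system
`H^i(E_n^∨)` to the system of the duals of `H^{-i}(E_n)` (`systemPairing`). The same `P` show that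
it is an isomorphism of pro-objects, and the target is the dual of the finite-dimensional space `V`
which represents the ind-object of the `H^{-i}(E_n)` (`exists_iso_proLim_dual`).
-/

noncomputable section

/-! ### A Baire category argument for countable unions of Banach spaces -/

section Baire

variable {X : Type*} [NormedAddCommGroup X] [NormedSpace ℂ X]

/-- The iteration at the end of the proof of the open mapping theorem: if a continuous linear map
with complete source has approximate preimages with control of the norm, it has exact ones. -/
lemma exists_preimage_norm_le_of_approx {P : Type*} [NormedAddCommGroup P] [NormedSpace ℂ P]
    [CompleteSpace P] (T : P →L[ℂ] X) {C : ℝ} (hC : 0 ≤ C)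
    (h : ∀ y, ∃ x, ‖y - T x‖ ≤ 1 / 2 * ‖y‖ ∧ ‖x‖ ≤ C * ‖y‖) (y : X) :
    ∃ x, T x = y ∧ ‖x‖ ≤ 2 * C * ‖y‖ := by
  choose g hg hgC using h
  let r : X → X := fun y => y - T (g y)
  have hr : ∀ n, ‖r^[n] y‖ ≤ (1 / 2) ^ n * ‖y‖ := by
    intro n
    induction n with
    | zero => simp
    | succ n ih =>
      rw [Function.iterate_succ_apply']
      calc ‖r (r^[n] y)‖ ≤ 1 / 2 * ‖r^[n] y‖ := hg _
        _ ≤ 1 / 2 * ((1 / 2) ^ n * ‖y‖) := by gcongr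
        _ = _ := by ring
  have hb : ∀ n, ‖g (r^[n] y)‖ ≤ C * ‖y‖ * (1 / 2) ^ n := fun n =>
    (hgC _).trans (by
      calc C * ‖r^[n] y‖ ≤ C * ((1 / 2) ^ n * ‖y‖) := by gcongr; exact hr n
        _ = _ := by ring)
  have hs : HasSum (fun n : ℕ => C * ‖y‖ * (1 / 2 : ℝ) ^ n) (C * ‖y‖ * 2) :=
    hasSum_geometric_two.mul_left _
  have hsum : Summable fun n => g (r^[n] y) :=
    Summable.of_norm_bounded hs.summable hb
  refine ⟨∑' n, g (r^[n] y), ?_, ?_⟩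
  · have h1 : Tendsto (fun N => T (∑ n ∈ Finset.range N, g (r^[n] y))) atTop
        (𝓝 (T (∑' n, g (r^[n] y)))) :=
      (T.continuous.tendsto _).comp hsum.hasSum.tendsto_sum_nat
    have h2 : ∀ N, T (∑ n ∈ Finset.range N, g (r^[n] y)) = y - r^[N] y := by
      intro N
      induction N with
      | zero => simp
      | succ N ih =>
        rw [Finset.sum_range_succ, map_add, ih, Function.iterate_succ_apply']
        simp only [r]; abel
    have h3 : Tendsto (fun N => r^[N] y) atTop (𝓝 0) := by
      refine squeeze_zero_norm hr ?_
      simpa using (tendsto_pow_atTop_nhds_zero_of_lt_one (r := (1 / 2 : ℝ)) (by norm_num)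
        (by norm_num)).mul_const ‖y‖
    have h4 : Tendsto (fun N => y - r^[N] y) atTop (𝓝 (y - 0)) := h3.const_sub y
    simp only [h2] at h1
    rw [sub_zero] at h4
    exact tendsto_nhds_unique h1 h4
  · exact (tsum_of_norm_bounded hs hb).trans (by linarith)

/-- A Banach space `X` which is the union of the projections of closed subspaces `S j ⊆ X × P j`,
with each `P j` a Banach space, is covered by a single one of these projections, with control of
the norm. -/
lemma exists_bounded_section [CompleteSpace X] {P : ℕ → Type*} [∀ j, NormedAddCommGroup (P j)]
    [∀ j, NormedSpace ℂ (P j)] [∀ j, CompleteSpace (P j)] (S : ∀ j, Submodule ℂ (X × P j))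
    (hS : ∀ j, IsClosed (S j : Set (X × P j))) (hcov : ∀ x, ∃ j p, (x, p) ∈ S j) :
    ∃ j C, ∀ x, ∃ p, (x, p) ∈ S j ∧ ‖p‖ ≤ C * ‖x‖ := by
  let T : ∀ j, S j →L[ℂ] X := fun j => (ContinuousLinearMap.fst ℂ X (P j)).comp (S j).subtypeL
  have hU : ⋃ jn : ℕ × ℕ, closure (T jn.1 '' Metric.ball 0 jn.2) = Set.univ := by
    refine Set.eq_univ_of_forall fun x => ?_
    obtain ⟨j, p, hp⟩ := hcov x
    obtain ⟨n, hn⟩ := exists_nat_gt ‖(⟨(x, p), hp⟩ : S j)‖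
    exact Set.mem_iUnion.2 ⟨(j, n), subset_closure ⟨⟨(x, p), hp⟩, by simpa using hn, rfl⟩⟩
  obtain ⟨⟨j, n⟩, a, ha⟩ :=
    nonempty_interior_of_iUnion_of_closed (fun jn : ℕ × ℕ => isClosed_closure) hU
  obtain ⟨ε, εpos, hε⟩ := Metric.mem_nhds_iff.1 (mem_interior_iff_mem_nhds.1 ha)
  have happ : ∀ y, ∃ x, ‖y - T j x‖ ≤ 1 / 2 * ‖y‖ ∧ ‖x‖ ≤ (2 * n * (2 / ε)) * ‖y‖ := by
    intro y
    rcases eq_or_ne y 0 with rfl | hy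
    · exact ⟨0, by simp⟩
    have hy' : 0 < ‖y‖ := norm_pos_iff.2 hy
    -- `c • y` has norm `ε / 2`; approximate `a + c • y` and `a` by images of the ball of radius `n`
    set c : ℝ := ε / 2 / ‖y‖ with hc
    have hcpos : 0 < c := by positivity
    have hcy : ‖c • y‖ = ε / 2 := by
      rw [norm_smul, Real.norm_of_nonneg hcpos.le, hc]; field_simp
    have hδ : 0 < ε / 8 := by positivity
    obtain ⟨_, ⟨x₁, hx₁, rfl⟩, h₁⟩ := Metric.mem_closure_iff.1
      (hε (show a + c • y ∈ Metric.ball a ε by rw [mem_ball_iff_norm]; simp [hcy]; linarith)) _ hδ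
    obtain ⟨_, ⟨x₂, hx₂, rfl⟩, h₂⟩ := Metric.mem_closure_iff.1
      (hε (Metric.mem_ball_self εpos)) _ hδ
    rw [dist_eq_norm] at h₁ h₂
    rw [mem_ball_zero_iff] at hx₁ hx₂
    refine ⟨c⁻¹ • (x₁ - x₂), ?_, ?_⟩
    · have h3 : y - T j (c⁻¹ • (x₁ - x₂))
          = c⁻¹ • ((a + c • y - T j x₁) - (a - T j x₂)) := by
        have h4 : T j (c⁻¹ • (x₁ - x₂)) = c⁻¹ • (T j x₁ - T j x₂) := by
          rw [← map_sub]; exact (T j : S j →ₗ[ℂ] X).map_smul_of_tower c⁻¹ (x₁ - x₂)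
        have h5 : y = c⁻¹ • c • y := (inv_smul_smul₀ hcpos.ne' y).symm
        rw [h4]
        nth_rewrite 1 [h5]
        rw [← smul_sub]
        congr 1
        abel
      rw [h3, norm_smul, norm_inv, Real.norm_of_nonneg hcpos.le]
      have h6 : ‖(a + c • y - T j x₁) - (a - T j x₂)‖ ≤ ε / 4 :=
        (norm_sub_le _ _).trans (by linarith)
      calc c⁻¹ * _ ≤ c⁻¹ * (ε / 4) := by gcongr
        _ = _ := by rw [hc]; field_simp; norm_num
    · rw [norm_smul, norm_inv, Real.norm_of_nonneg hcpos.le]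
      have h6 : ‖x₁ - x₂‖ ≤ 2 * n := (norm_sub_le _ _).trans (by linarith)
      calc c⁻¹ * _ ≤ c⁻¹ * (2 * n) := by gcongr
        _ = _ := by rw [hc]; field_simp
  have : CompleteSpace (S j) := (hS j).completeSpace_coe
  refine ⟨j, 2 * (2 * n * (2 / ε)), fun x => ?_⟩
  obtain ⟨⟨⟨x', p⟩, hs⟩, rfl, hn⟩ :=
    exists_preimage_norm_le_of_approx (T j) (by positivity) happ x
  exact ⟨p, hs, (norm_snd_le (x', p)).trans hn⟩

end Baire

/-! ### Bounded linear maps and DFN-spaces -/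

section BoundedMaps

variable {E F G : Type*}

lemma IsBoundedMap.comp [Bornology E] [Bornology F] [Bornology G] {g : F → G} {f : E → F}
    (hg : IsBoundedMap g) (hf : IsBoundedMap f) : IsBoundedMap (g ∘ f) := fun s hs => by
  rw [Set.image_comp]; exact hg (hf hs)

lemma IsBoundedMap.add [Bornology E] [Bornology F] [Add F] [BoundedAdd F] {f g : E → F}
    (hf : IsBoundedMap f) (hg : IsBoundedMap g) : IsBoundedMap (fun x => f x + g x) :=
  fun s hs => (isBounded_add (hf hs) (hg hs)).subset (by
    rintro _ ⟨x, hx, rfl⟩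
    exact Set.add_mem_add ⟨x, hx, rfl⟩ ⟨x, hx, rfl⟩)

lemma isBoundedMap_const [Bornology E] [Bornology F] (c : F) : IsBoundedMap (fun _ : E => c) :=
  fun _ _ => (isBounded_singleton (x := c)).subset (by rintro _ ⟨x, _, rfl⟩; rfl)

lemma IsBoundedMap.sum [Bornology E] [Bornology F] [AddCommMonoid F] [BoundedAdd F] {ι : Type*}
    (s : Finset ι) {f : ι → E → F} (hf : ∀ i, IsBoundedMap (f i)) :
    IsBoundedMap (fun x => ∑ i ∈ s, f i x) := by
  classical
  induction s using Finset.induction_on with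
  | empty => simpa using isBoundedMap_const (0 : F)
  | insert a s ha ih =>
    simp only [Finset.sum_insert ha]
    exact (hf a).add ih

lemma ContinuousLinearMap.isBoundedMap {X Y : Type*} [NormedAddCommGroup X] [NormedSpace ℂ X]
    [NormedAddCommGroup Y] [NormedSpace ℂ Y] (f : X →L[ℂ] Y) : IsBoundedMap f :=
  fun _ hs => f.lipschitz.isBounded_image hs

lemma ConvexBornology.isBoundedMap_neg [AddCommGroup E] [Module ℂ E] [Bornology E]
    [ConvexBornology E] : IsBoundedMap (fun x : E => -x) := fun s hs =>
  (ConvexBornology.isBounded_smul (isBounded_singleton (x := (-1 : ℂ))) hs).subset (by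
    rintro _ ⟨x, hx, rfl⟩
    exact ⟨-1, rfl, x, hx, by simp⟩)

lemma IsBoundedMap.neg [Bornology E] [AddCommGroup F] [Module ℂ F] [Bornology F]
    [ConvexBornology F] {f : E → F} (hf : IsBoundedMap f) : IsBoundedMap (fun x => -f x) :=
  ConvexBornology.isBoundedMap_neg.comp hf

lemma BornologicalModule.isBoundedMap_smul {A : Type*} [Bornology A] [Bornology E] [SMul A E]
    [BornologicalModule A E] (y : E) : IsBoundedMap (fun a : A => a • y) := fun s hs =>
  (BornologicalModule.isBounded_smul hs (isBounded_singleton (x := y))).subset (by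
    rintro _ ⟨x, hx, rfl⟩
    exact Set.smul_mem_smul hx rfl)

end BoundedMaps

namespace DFNPresentation

attribute [instance] normedAddCommGroup normedSpace completeSpace

variable {E : Type u} [AddCommGroup E] [Module ℂ E] [Bornology E] (P : DFNPresentation E)

lemma exists_transition {n m : ℕ} (h : n ≤ m) :
    ∃ T : P.space n →L[ℂ] P.space m, ∀ x, P.incl m (T x) = P.incl n x := by
  induction m, h using Nat.le_induction with
  | base => exact ⟨ContinuousLinearMap.id ℂ _, fun x => rfl⟩
  | succ m h ih =>
    obtain ⟨T, hT⟩ := ih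
    exact ⟨(P.transition m).comp T, fun x => by
      rw [ContinuousLinearMap.comp_apply, P.incl_transition, hT]⟩

lemma isBoundedMap_incl (n : ℕ) : IsBoundedMap (P.incl n) :=
  fun t ht => (P.isBounded_iff _).2 ⟨n, t, ht, rfl⟩

/-- Every bounded set is contained in the image of a ball of one of the Banach spaces. -/
lemma exists_subset_image_closedBall {s : Set E} (hs : IsBounded s) :
    ∃ n R, 0 ≤ R ∧ s ⊆ P.incl n '' Metric.closedBall 0 R := by
  obtain ⟨n, t, ht, rfl⟩ := (P.isBounded_iff s).1 hs
  obtain ⟨R, hR⟩ := ht.subset_closedBall 0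
  exact ⟨n, max R 0, le_max_right _ _,
    Set.image_mono (hR.trans (Metric.closedBall_subset_closedBall (le_max_left _ _)))⟩

/-- A bounded linear map from a normed space factors through one of the Banach spaces. -/
lemma exists_factorization {X : Type*} [NormedAddCommGroup X] [NormedSpace ℂ X] (f : X →ₗ[ℂ] E)
    (hf : IsBoundedMap f) : ∃ n, ∃ g : X →L[ℂ] P.space n, ∀ x, P.incl n (g x) = f x := by
  obtain ⟨n, R, hR, hs⟩ := P.exists_subset_image_closedBall
    (hf (Metric.isBounded_closedBall (x := (0 : X)) (r := 1)))
  have hrange : ∀ x, f x ∈ LinearMap.range (P.incl n) := by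
    intro x
    have hx : ((‖x‖ + 1 : ℝ) : ℂ)⁻¹ • x ∈ Metric.closedBall (0 : X) 1 := by
      have h0 : 0 < ‖x‖ + 1 := by positivity
      rw [mem_closedBall_zero_iff, norm_smul, norm_inv, Complex.norm_real,
        Real.norm_of_nonneg h0.le, inv_mul_le_iff₀ h0]
      linarith
    obtain ⟨y, -, hy⟩ := hs ⟨_, hx, rfl⟩
    have h0 : ((‖x‖ + 1 : ℝ) : ℂ) ≠ 0 := by
      have : 0 < ‖x‖ + 1 := by positivity
      exact_mod_cast this.ne'
    exact ⟨((‖x‖ + 1 : ℝ) : ℂ) • y, by rw [map_smul, hy, map_smul, smul_inv_smul₀ h0]⟩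
  let g : X →ₗ[ℂ] P.space n := (LinearEquiv.ofInjective _ (P.incl_injective n)).symm.toLinearMap.comp
    (f.codRestrict _ hrange)
  have hg : ∀ x, P.incl n (g x) = f x := fun x =>
    congrArg Subtype.val ((LinearEquiv.ofInjective _ (P.incl_injective n)).apply_symm_apply
      (f.codRestrict _ hrange x))
  have hb : ∀ z ∈ Metric.ball (0 : X) 1, ‖g z‖ ≤ R := by
    intro z hz
    obtain ⟨y, hy, hyz⟩ := hs ⟨z, Metric.ball_subset_closedBall hz, rfl⟩
    rw [← hg] at hyz
    rw [← P.incl_injective n hyz]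
    simpa using hy
  exact ⟨n, g.mkContinuousOfExistsBound (LinearMap.bound_of_ball_bound one_pos R g hb), hg⟩

end DFNPresentation

/-- The kernel of a bounded linear map from a normed space is closed. -/
lemma IsDFNSpace.isClosed_ker {E : Type u} [AddCommGroup E] [Module ℂ E] [Bornology E]
    (hE : IsDFNSpace E) {X : Type*} [NormedAddCommGroup X] [NormedSpace ℂ X] (f : X →ₗ[ℂ] E)
    (hf : IsBoundedMap f) : IsClosed (LinearMap.ker f : Set X) := by
  obtain ⟨P⟩ := hE
  obtain ⟨n, g, hg⟩ := P.exists_factorization f hf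
  have : (LinearMap.ker f : Set X) = g ⁻¹' {0} := by
    ext x
    simp only [SetLike.mem_coe, LinearMap.mem_ker, Set.mem_preimage, Set.mem_singleton_iff, ← hg]
    exact map_eq_zero_iff _ (P.incl_injective n)
  rw [this]
  exact isClosed_singleton.preimage g.continuous

/-! ### Convergent sequences and nuclear operators -/

section Convergence

variable {E : Type u} [AddCommGroup E] [Module ℂ E] [Bornology E]
  {F : Type v} [AddCommGroup F] [Module ℂ F] [Bornology F]

/-- Limits are unique in a DFN-space, since the Banach spaces defining it embed into it. -/
lemma BornTendsto.unique (hE : IsDFNSpace E) {s : ℕ → E} {x y : E} (hx : BornTendsto s x)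
    (hy : BornTendsto s y) : x = y := by
  obtain ⟨P⟩ := hE
  obtain ⟨B, hB, -, -, ε, hε, hs⟩ := hx
  obtain ⟨B', hB', -, -, ε', hε', hs'⟩ := hy
  obtain ⟨n, R, hR, hBn⟩ := P.exists_subset_image_closedBall (hB.union hB')
  choose b hb hbs using hs
  choose b' hb' hbs' using hs'
  choose c hc hcb using fun k => hBn (Or.inl (hb k))
  choose c' hc' hcb' using fun k => hBn (Or.inr (hb' k))
  have key : ∀ k, P.incl n (ε k • c k - ε' k • c' k) = y - x := by
    intro k
    rw [map_sub, LinearMap.map_smul_of_tower, LinearMap.map_smul_of_tower, hcb, hcb']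
    simp only at hbs hbs'
    rw [hbs, hbs']
    abel
  have hconst : ∀ k, ε k • c k - ε' k • c' k = ε 0 • c 0 - ε' 0 • c' 0 := fun k =>
    P.incl_injective n ((key k).trans (key 0).symm)
  have hlim : ∀ (ε : ℕ → ℝ) (c : ℕ → P.space n), Tendsto ε atTop (𝓝 0) →
      (∀ k, c k ∈ Metric.closedBall 0 R) → Tendsto (fun k => ε k • c k) atTop (𝓝 0) := by
    intro ε c hε hc
    refine squeeze_zero_norm (a := fun k => ‖ε k‖ * R) (fun k => ?_) ?_
    · rw [norm_smul]
      exact mul_le_mul_of_nonneg_left (by simpa using hc k) (norm_nonneg _)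
    · simpa using hε.norm.mul_const R
  have h0 := (hlim ε c hε hc).sub (hlim ε' c' hε' hc')
  simp only [hconst, sub_zero] at h0
  have h1 := tendsto_nhds_unique tendsto_const_nhds h0
  have h2 := key 0
  rw [h1, map_zero] at h2
  exact (sub_eq_zero.1 h2.symm).symm

lemma BornTendsto.map {s : ℕ → E} {x : E} (h : BornTendsto s x) (f : E →ₗ[ℂ] F)
    (hf : IsBoundedMap f) : BornTendsto (fun n => f (s n)) (f x) := by
  obtain ⟨B, hB, hc, hb, ε, hε, hs⟩ := h
  refine ⟨f '' B, hf hB, hc.linear_image (f.restrictScalars ℝ), ?_, ε, hε, fun n => ?_⟩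
  · rintro a ha _ ⟨_, ⟨y, hy, rfl⟩, rfl⟩
    exact ⟨a • y, hb a ha ⟨y, hy, rfl⟩, map_smul f a y⟩
  · obtain ⟨y, hy, hyn⟩ := hs n
    refine ⟨f y, ⟨y, hy, rfl⟩, ?_⟩
    simp only at hyn ⊢
    rw [← map_sub, ← hyn, LinearMap.map_smul_of_tower]

lemma BornTendsto.add [BoundedAdd E] {s t : ℕ → E} {x y : E} (hs : BornTendsto s x)
    (ht : BornTendsto t y) : BornTendsto (fun n => s n + t n) (x + y) := by
  obtain ⟨B, hB, hc, hb, ε, hε, hs⟩ := hs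
  obtain ⟨B', hB', hc', hb', ε', hε', ht⟩ := ht
  refine ⟨B + B', isBounded_add hB hB', hc.add hc', hb.add hb', fun n => max ‖ε n‖ ‖ε' n‖, ?_,
    fun n => ?_⟩
  · simpa using hε.norm.max hε'.norm
  -- a balanced set only grows when the scalar does
  · have aux : ∀ {B : Set E} {a c : ℝ} {z : E}, Balanced ℂ B → ‖a‖ ≤ c → z ∈ a • B → z ∈ c • B := by
      rintro B a c z hB hac ⟨w, hw, rfl⟩
      have h := hB.smul_mono (a := (a : ℂ)) (b := (c : ℂ)) (by
        rw [Complex.norm_real, Complex.norm_real, Real.norm_of_nonneg ((norm_nonneg _).trans hac)]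
        exact hac)
      obtain ⟨w', hw', h'⟩ := h ⟨w, hw, rfl⟩
      exact ⟨w', hw', by simpa using h'⟩
    have h1 := aux hb (le_max_left _ ‖ε' n‖) (hs n)
    have h2 := aux hb' (le_max_right ‖ε n‖ _) (ht n)
    have h3 := Set.add_mem_add h1 h2
    rw [← smul_add] at h3
    convert h3 using 1
    exact add_sub_add_comm _ _ _ _

lemma BornTendsto.sum [BoundedAdd E] {ι : Type*} (t : Finset ι) {s : ι → ℕ → E} {x : ι → E}
    (h : ∀ i, BornTendsto (s i) (x i)) :
    BornTendsto (fun n => ∑ i ∈ t, s i n) (∑ i ∈ t, x i) := by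
  classical
  induction t using Finset.induction_on with
  | empty =>
    refine ⟨{0}, isBounded_singleton, convex_singleton 0, ?_, fun _ => 0, tendsto_const_nhds,
      fun n => ⟨0, rfl, by simp⟩⟩
    rintro a - _ ⟨y, rfl, rfl⟩
    simp
  | insert a s ha ih =>
    simp only [Finset.sum_insert ha]
    exact (h a).add ih

/-- In a DFN-space, a series with bounded terms and summable coefficients converges, and its sum
stays in a bounded set depending only on a bounded set containing the terms. -/
lemma IsDFNSpace.exists_bornTendsto (hE : IsDFNSpace E) {lam : ℕ → ℝ} (h0 : ∀ n, 0 ≤ lam n)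
    (hlam : Summable lam) {B : Set E} (hB : IsBounded B) :
    ∃ B' : Set E, IsBounded B' ∧ ∀ c : ℕ → E, (∀ n, c n ∈ B) →
      ∃ x ∈ B', BornTendsto (fun N => ∑ n ∈ Finset.range N, (lam n : ℂ) • c n) x := by
  obtain ⟨P⟩ := hE
  obtain ⟨k, R, hR, hBk⟩ := P.exists_subset_image_closedBall hB
  refine ⟨P.incl k '' Metric.closedBall 0 ((∑' n, lam n) * R),
    P.isBoundedMap_incl k Metric.isBounded_closedBall, fun c hc => ?_⟩
  choose t ht htc using fun n => hBk (hc n)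
  have hbd : ∀ n, ‖(lam n : ℂ) • t n‖ ≤ lam n * R := fun n => by
    rw [norm_smul, Complex.norm_real, Real.norm_of_nonneg (h0 n)]
    exact mul_le_mul_of_nonneg_left (by simpa using ht n) (h0 n)
  have hs : Summable fun n => (lam n : ℂ) • t n :=
    Summable.of_norm_bounded (hlam.mul_right R) hbd
  refine ⟨P.incl k (∑' n, (lam n : ℂ) • t n), ⟨_, ?_, rfl⟩, ?_⟩
  · rw [mem_closedBall_zero_iff]
    exact tsum_of_norm_bounded (hlam.hasSum.mul_right R) hbd
  · refine ⟨P.incl k '' Metric.closedBall 0 R, P.isBoundedMap_incl k Metric.isBounded_closedBall,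
      (convex_closedBall _ _).linear_image ((P.incl k).restrictScalars ℝ), ?_,
      fun N => ∑' n, lam (n + N), tendsto_sum_nat_add lam, fun N => ?_⟩
    · rintro a ha _ ⟨_, ⟨y, hy, rfl⟩, rfl⟩
      refine ⟨a • y, balanced_closedBall_zero a ha ⟨y, hy, rfl⟩, map_smul _ _ _⟩
    · have htail : ‖(∑ n ∈ Finset.range N, (lam n : ℂ) • t n) - ∑' n, (lam n : ℂ) • t n‖
          ≤ (∑' n, lam (n + N)) * R := by
        rw [← hs.sum_add_tsum_nat_add N, sub_add_cancel_left, norm_neg]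
        exact tsum_of_norm_bounded (((summable_nat_add_iff N).2 hlam).hasSum.mul_right R)
          fun n => hbd (n + N)
      have hmem : (∑ n ∈ Finset.range N, (lam n : ℂ) • t n) - ∑' n, (lam n : ℂ) • t n
          ∈ (∑' n, lam (n + N)) • Metric.closedBall (0 : P.space k) R := by
        rw [smul_closedBall _ _ hR, smul_zero, mem_closedBall_zero_iff,
          Real.norm_of_nonneg (tsum_nonneg fun n => h0 _)]
        exact htail
      obtain ⟨y, hy, hyN⟩ := hmem
      refine ⟨_, ⟨y, hy, rfl⟩, ?_⟩
      simp only at hyN ⊢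
      rw [← LinearMap.map_smul_of_tower, hyN, map_sub, map_sum]
      simp only [map_smul, htc]

end Convergence

/-! ### Nuclear operators and bounded liftings -/

namespace DFNModuleCat

section

variable {A : Type u} [CommRing A] [Algebra ℂ A] [Bornology A]

/-- Summable coefficients, a bounded sequence of bounded forms and a bounded sequence of vectors
define a bounded `A`-linear map. -/
lemma exists_nuclear_operator {E : Type u} [AddCommGroup E] [Module A E] [Bornology E]
    {F : Type u} [AddCommGroup F] [Module ℂ F] [Module A F] [IsScalarTower ℂ A F] [Bornology F]
    [ConvexBornology F] [BornologicalModule A F] (hF : IsDFNSpace F) {lam : ℕ → ℝ} {u : ℕ → E →ₗ[A] A} {z : ℕ → F}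
    (h0 : ∀ n, 0 ≤ lam n) (hlam : Summable lam)
    (hu : ∀ s : Set E, IsBounded s → IsBounded (⋃ n, u n '' s)) (hz : IsBounded (Set.range z)) :
    ∃ h : E →ₗ[A] F, IsBoundedMap h ∧ ∀ x,
      BornTendsto (fun N => ∑ n ∈ Finset.range N, (lam n : ℂ) • u n x • z n) (h x) := by
  have hsum : ∀ s : Set E, IsBounded s → ∃ B' : Set F, IsBounded B' ∧ ∀ x ∈ s, ∃ y ∈ B',
      BornTendsto (fun N => ∑ n ∈ Finset.range N, (lam n : ℂ) • u n x • z n) y := by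
    intro s hs
    obtain ⟨B', hB', h⟩ := hF.exists_bornTendsto h0 hlam
      (BornologicalModule.isBounded_smul (hu s hs) hz)
    exact ⟨B', hB', fun x hx => h (fun n => u n x • z n) fun n => Set.smul_mem_smul
      (Set.mem_iUnion.2 ⟨n, x, hx, rfl⟩) ⟨n, rfl⟩⟩
  have hex : ∀ x, ∃ y, BornTendsto (fun N => ∑ n ∈ Finset.range N, (lam n : ℂ) • u n x • z n) y :=
    fun x => by
      obtain ⟨B', -, h⟩ := hsum {x} isBounded_singleton
      obtain ⟨y, -, hy⟩ := h x rfl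
      exact ⟨y, hy⟩
  choose h hh using hex
  refine ⟨{ toFun := h, map_add' := fun x y => ?_, map_smul' := fun a x => ?_ }, ?_, hh⟩
  · refine (hh (x + y)).unique hF ?_
    convert (hh x).add (hh y) using 2 with N
    simp only [map_add, add_smul, smul_add, Finset.sum_add_distrib]
  · refine (hh (a • x)).unique hF ?_
    have hb : IsBoundedMap (Algebra.lsmul ℂ ℂ F a) := fun s hs =>
      (BornologicalModule.isBounded_smul (isBounded_singleton (x := a)) hs).subset (by
        rintro _ ⟨y, hy, rfl⟩
        exact Set.smul_mem_smul rfl hy)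
    have h1 := (hh x).map (Algebra.lsmul ℂ ℂ F a) hb
    rw [Algebra.lsmul_coe] at h1
    convert h1 using 2 with N
    · simp only [map_smul, smul_eq_mul, mul_smul, Finset.smul_sum]
      exact Finset.sum_congr rfl fun n _ => smul_comm _ _ _
    · rfl
  · intro s hs
    obtain ⟨B', hB', hB⟩ := hsum s hs
    refine hB'.subset ?_
    rintro _ ⟨x, hx, rfl⟩
    obtain ⟨y, hy, hxy⟩ := hB x hx
    change h x ∈ B'
    rwa [(hh x).unique hF hxy]

variable [DFNAlgebra A] {M N G Q : DFNModuleCat.{u} A}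

/-- If `f` maps the kernel of `δ` into the submodule generated by the range of `d` and finitely
many vectors, then the coefficients of these vectors and the preimage under `d` can be chosen in
bounded sets when the argument runs through a bounded subset of the kernel of `δ`. The kernel of `δ`
in one of the Banach spaces defining `M` is the union, over the steps `j` of `A` and `G`, of the
projections of closed subspaces, so that the Baire category argument applies. -/
lemma exists_bounded_lift {f : M →ₗ[A] N} (hf : IsBoundedMap f) {δ : M →ₗ[A] Q}
    (hδ : IsBoundedMap δ) {d : G →ₗ[A] N} (hd : IsBoundedMap d) {r : ℕ} (w : Fin r → N)
    (h : ∀ x, δ x = 0 → ∃ (a : Fin r → A) (y : G), f x = ∑ i, a i • w i + d y)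
    {B : Set M} (hB : IsBounded B) :
    ∃ (BA : Set A) (BG : Set G), IsBounded BA ∧ IsBounded BG ∧ ∀ x ∈ B, δ x = 0 →
      ∃ (a : Fin r → A) (y : G), (∀ i, a i ∈ BA) ∧ y ∈ BG ∧ f x = ∑ i, a i • w i + d y := by
  obtain ⟨PM⟩ := M.isDFNSpace
  obtain ⟨PG⟩ := G.isDFNSpace
  obtain ⟨PA⟩ := DFNAlgebra.isDFNSpace (A := A)
  obtain ⟨n, R, hR, hBn⟩ := PM.exists_subset_image_closedBall hB
  let X : Submodule ℂ (PM.space n) := LinearMap.ker ((δ.restrictScalars ℂ).comp (PM.incl n))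
  have hX : IsClosed (X : Set (PM.space n)) :=
    Q.isDFNSpace.isClosed_ker _ (IsBoundedMap.comp (g := δ) hδ (PM.isBoundedMap_incl n))
  have : CompleteSpace X := hX.completeSpace_coe
  let T : ∀ j, (Fin r → PA.space j) × PG.space j →ₗ[ℂ] N := fun j =>
    ∑ i, (((LinearMap.toSpanSingleton A N (w i)).restrictScalars ℂ).comp (PA.incl j)).comp
      ((LinearMap.proj i).comp (LinearMap.fst ℂ _ _)) +
    ((d.restrictScalars ℂ).comp (PG.incl j)).comp (LinearMap.snd ℂ _ _)
  have hTapp : ∀ j p, T j p = ∑ i, PA.incl j (p.1 i) • w i + d (PG.incl j p.2) := fun j p => by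
    simp [T]
  let Φ : ∀ j, X × ((Fin r → PA.space j) × PG.space j) →ₗ[ℂ] N := fun j =>
    (((f.restrictScalars ℂ).comp (PM.incl n)).comp X.subtype).comp (LinearMap.fst ℂ _ _) -
      (T j).comp (LinearMap.snd ℂ _ _)
  have hΦapp : ∀ j q, Φ j q = f (PM.incl n q.1) - T j q.2 := fun j q => rfl
  have hΦ : ∀ j, IsBoundedMap (Φ j) := by
    intro j
    have h1 : IsBoundedMap fun q : X × ((Fin r → PA.space j) × PG.space j) =>
        f (PM.incl n q.1) :=
      hf.comp ((PM.isBoundedMap_incl n).comp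
        (X.subtypeL.comp (ContinuousLinearMap.fst ℂ X
          ((Fin r → PA.space j) × PG.space j))).isBoundedMap)
    have h2 : ∀ i, IsBoundedMap fun q : X × ((Fin r → PA.space j) × PG.space j) =>
        PA.incl j (q.2.1 i) • w i := fun i =>
      (BornologicalModule.isBoundedMap_smul (w i)).comp ((PA.isBoundedMap_incl j).comp
        (((ContinuousLinearMap.proj (R := ℂ) (φ := fun _ : Fin r => PA.space j) i).comp
          (ContinuousLinearMap.fst ℂ _ (PG.space j))).comp
            (ContinuousLinearMap.snd ℂ X _)).isBoundedMap)
    have h3 : IsBoundedMap fun q : X × ((Fin r → PA.space j) × PG.space j) =>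
        d (PG.incl j q.2.2) :=
      hd.comp ((PG.isBoundedMap_incl j).comp
        ((ContinuousLinearMap.snd ℂ (Fin r → PA.space j) (PG.space j)).comp
          (ContinuousLinearMap.snd ℂ X _)).isBoundedMap)
    have h4 := h1.add ((IsBoundedMap.sum Finset.univ h2).add h3).neg
    convert h4 using 2 with q
    rw [hΦapp, hTapp, sub_eq_add_neg]
  have hcov : ∀ x : X, ∃ j p, (x, p) ∈ LinearMap.ker (Φ j) := by
    intro x
    obtain ⟨a, y, hxy⟩ := h (PM.incl n x) x.2
    choose k b hb using fun i => PA.incl_surjective (a i)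
    obtain ⟨l, y', rfl⟩ := PG.incl_surjective y
    let j := max l (Finset.univ.sup k)
    have hkj : ∀ i, k i ≤ j := fun i =>
      (Finset.le_sup (Finset.mem_univ i)).trans (le_max_right _ _)
    choose τ hτ using fun i => PA.exists_transition (hkj i)
    obtain ⟨σ, hσ⟩ := PG.exists_transition (le_max_left l (Finset.univ.sup k))
    refine ⟨j, (fun i => τ i (b i), σ y'), ?_⟩
    rw [LinearMap.mem_ker, hΦapp, hTapp, hxy, sub_eq_zero]
    simp only [j, hτ, hσ, hb]
  obtain ⟨j, C, hC⟩ := exists_bounded_section (fun j => LinearMap.ker (Φ j))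
    (fun j => N.isDFNSpace.isClosed_ker _ (hΦ j)) hcov
  refine ⟨PA.incl j '' Metric.closedBall 0 (|C| * R), PG.incl j '' Metric.closedBall 0 (|C| * R),
    PA.isBoundedMap_incl j Metric.isBounded_closedBall,
    PG.isBoundedMap_incl j Metric.isBounded_closedBall, fun x hx hδx => ?_⟩
  obtain ⟨x', hx', rfl⟩ := hBn hx
  obtain ⟨p, hp, hpn⟩ := hC ⟨x', hδx⟩
  have hp' : ‖p‖ ≤ |C| * R := hpn.trans (mul_le_mul (le_abs_self C) (by simpa using hx')
    (norm_nonneg _) (abs_nonneg C))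
  rw [LinearMap.mem_ker, hΦapp, hTapp, sub_eq_zero] at hp
  refine ⟨fun i => PA.incl j (p.1 i), PG.incl j p.2, fun i => ⟨_, ?_, rfl⟩, ⟨_, ?_, rfl⟩, hp⟩
  · rw [mem_closedBall_zero_iff]
    exact ((norm_le_pi_norm p.1 i).trans (norm_fst_le p)).trans hp'
  · rw [mem_closedBall_zero_iff]
    exact (norm_snd_le p).trans hp'

/-- If `u` is nuclear, `v` takes its values in the kernel of `δ`, and `f` maps this kernel into the
submodule generated by the range of `d` and finitely many vectors `w i`, then `f ∘ v ∘ u` is the sum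
of a finite rank map with values in the span of the `w i` and of a map which lifts boundedly
through `d`. Nuclearity replaces an arbitrary vector by a bounded sequence in the kernel of `δ`,
to which bounded lifting applies. -/
lemma exists_finite_rank_add_lift {L : DFNModuleCat.{u} A} {u : L →ₗ[A] M} (hu : IsNuclear A u)
    {K : DFNModuleCat.{u} A} {v : M →ₗ[A] K} (hv : IsBoundedMap v) {δ : K →ₗ[A] Q}
    (hδ : IsBoundedMap δ) (hδv : ∀ x, δ (v x) = 0) {f : K →ₗ[A] N} (hf : IsBoundedMap f)
    {d : G →ₗ[A] N} (hd : IsBoundedMap d) {r : ℕ} (w : Fin r → N)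
    (h : ∀ x, δ x = 0 → ∃ (a : Fin r → A) (y : G), f x = ∑ i, a i • w i + d y) :
    ∃ (ξ : Fin r → L →ₗ[A] A) (η : L →ₗ[A] G), (∀ i, IsBoundedMap (ξ i)) ∧ IsBoundedMap η ∧
      ∀ x, f (v (u x)) = ∑ i, ξ i x • w i + d (η x) := by
  obtain ⟨lam, φ, y, h0, hlam, -, hφ, hy, hlim⟩ := hu
  obtain ⟨BA, BG, hBA, hBG, hlift⟩ := exists_bounded_lift hf hδ hd w h (hv hy)
  choose a z ha hz haz using fun n => hlift (v (y n)) ⟨y n, ⟨n, rfl⟩, rfl⟩ (hδv _)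
  choose ξ hξ hξlim using fun i => exists_nuclear_operator (DFNAlgebra.isDFNSpace (A := A)) (z := fun n => a n i) h0 hlam
    hφ (hBA.subset (by rintro _ ⟨n, rfl⟩; exact ha n i))
  obtain ⟨η, hη, hηlim⟩ := exists_nuclear_operator G.isDFNSpace (z := z) h0 hlam hφ
    (hBG.subset (by rintro _ ⟨n, rfl⟩; exact hz n))
  refine ⟨ξ, η, hξ, hη, fun x => ?_⟩
  have h1 := ((hlim x).map (v.restrictScalars ℂ) hv).map (f.restrictScalars ℂ) hf
  have h2 := (hηlim x).map (d.restrictScalars ℂ) hd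
  have h3 := BornTendsto.sum Finset.univ fun i => (hξlim i x).map
    ((LinearMap.toSpanSingleton A N (w i)).restrictScalars ℂ)
    (BornologicalModule.isBoundedMap_smul (w i))
  refine (h1.unique N.isDFNSpace ?_ :
    f (v (u x)) = ∑ i, LinearMap.toSpanSingleton A N (w i) (ξ i x) + d (η x))
  convert h3.add h2 using 2 with k
  · simp only [map_sum]
    rw [Finset.sum_comm, ← Finset.sum_add_distrib]
    refine Finset.sum_congr rfl fun n _ => ?_
    simp only [map_smul, LinearMap.coe_restrictScalars, haz, LinearMap.toSpanSingleton_apply,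
      smul_add, Finset.smul_sum, smul_eq_mul, mul_smul]
  · rfl
  · rfl

end

end DFNModuleCat

/-! ### Sequential ind-objects and pro-objects -/

section IndPro

open Limits

variable {C : Type v} [Category.{w} C]

/-- Morphisms out of an object of `C` in `Ind C`, as sections of a presheaf. -/
def coyonedaIndYonedaIso (V : C) : coyoneda.obj (op (Ind.yoneda.obj V)) ≅
    Ind.inclusion C ⋙ (evaluation Cᵒᵖ (Type w)).obj (op V) :=
  NatIso.ofComponents (fun Z => Equiv.toIso
    ((Ind.inclusion.fullyFaithful (C := C)).homEquiv.trans
      (((Ind.yonedaCompInclusion (C := C)).app V).homFromEquiv.trans yonedaEquiv)))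
    (by
      intro Z Z' f
      ext g
      simp [yonedaEquiv])

instance (V : C) {J : Type w} [SmallCategory J] [IsFiltered J] :
    PreservesColimitsOfShape J (coyoneda.obj (op (Ind.yoneda.obj V))) :=
  preservesColimitsOfShape_of_natIso (coyonedaIndYonedaIso V).symm

/-- The terms of the inductive system are compatible with the canonical morphisms. -/
lemma indι_w (X : ℕ ⥤ C) {n m : ℕ} (h : n ≤ m) :
    Ind.yoneda.map (X.map (homOfLE h)) ≫ indι X m = indι X n :=
  colimit.w ((AsSmall.down.{0, 0, w} (C := ℕ) ⋙ X) ⋙ Ind.yoneda)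
    (AsSmall.up.map (homOfLE h) : AsSmall.up.obj n ⟶ AsSmall.up.obj m)

lemma indLim_hom_ext {X : ℕ ⥤ C} {Z : Ind C} {f g : indLim.obj X ⟶ Z}
    (h : ∀ n, indι X n ≫ f = indι X n ≫ g) : f = g :=
  colimit.hom_ext (F := (AsSmall.down.{0, 0, w} (C := ℕ) ⋙ X) ⋙ Ind.yoneda) fun n =>
    h (AsSmall.down.obj n)

/-- The morphism out of a sequential ind-object defined by a compatible family. -/
def indDesc {X : ℕ ⥤ C} {Z : Ind C} (t : ∀ n, Ind.yoneda.obj (X.obj n) ⟶ Z)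
    (h : ∀ {n m : ℕ} (hnm : n ≤ m), Ind.yoneda.map (X.map (homOfLE hnm)) ≫ t m = t n) :
    indLim.obj X ⟶ Z :=
  colimit.desc ((AsSmall.down.{0, 0, w} (C := ℕ) ⋙ X) ⋙ Ind.yoneda)
    { pt := Z
      ι := { app := fun n => t (AsSmall.down.obj n)
             naturality := fun n m f => by
              have := h (leOfHom (AsSmall.down.map f))
              rw [Functor.const_obj_map]
              exact this.trans (Category.comp_id _).symm } }

lemma indι_indDesc {X : ℕ ⥤ C} {Z : Ind C} (t : ∀ n, Ind.yoneda.obj (X.obj n) ⟶ Z)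
    (h : ∀ {n m : ℕ} (hnm : n ≤ m), Ind.yoneda.map (X.map (homOfLE hnm)) ≫ t m = t n) (n : ℕ) :
    indι X n ≫ indDesc t h = t n :=
  colimit.ι_desc _ _

lemma indι_map {X Y : ℕ ⥤ C} (β : X ⟶ Y) (n : ℕ) :
    indι X n ≫ indLim.map β = Ind.yoneda.map (β.app n) ≫ indι Y n :=
  ι_colimMap _ _

/-- Objects of `C` are compact in `Ind C`: a morphism from one of them to a sequential ind-object
factors through a term of the system. -/
lemma exists_eq_comp_indι {X : ℕ ⥤ C} {V : C} (f : Ind.yoneda.obj V ⟶ indLim.obj X) :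
    ∃ n, ∃ g : V ⟶ X.obj n, f = Ind.yoneda.map g ≫ indι X n := by
  have hc := isColimitOfPreserves (coyoneda.obj (op (Ind.yoneda.obj V)))
    (colimit.isColimit ((AsSmall.down.{0, 0, w} (C := ℕ) ⋙ X) ⋙ Ind.yoneda))
  obtain ⟨j, y, hy⟩ := Types.jointly_surjective_of_isColimit hc f
  exact ⟨AsSmall.down.obj j, Ind.yoneda.preimage y, by rw [Functor.map_preimage]; exact hy.symm⟩

/-- Objects of `C` are compact in `Ind C`: morphisms to a term of the system which agree in the
ind-object agree at a later index. -/
lemma exists_map_eq_of_comp_indι_eq {X : ℕ ⥤ C} {V : C} {n : ℕ} {g g' : V ⟶ X.obj n}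
    (h : Ind.yoneda.map g ≫ indι X n = Ind.yoneda.map g' ≫ indι X n) :
    ∃ m, ∃ hnm : n ≤ m, g ≫ X.map (homOfLE hnm) = g' ≫ X.map (homOfLE hnm) := by
  have hc := isColimitOfPreserves (coyoneda.obj (op (Ind.yoneda.obj V)))
    (colimit.isColimit ((AsSmall.down.{0, 0, w} (C := ℕ) ⋙ X) ⋙ Ind.yoneda))
  obtain ⟨k, p, q, hpq⟩ := (Types.FilteredColimit.isColimit_eq_iff _ hc
    (i := AsSmall.up.obj n) (j := AsSmall.up.obj n)
    (xi := Ind.yoneda.map g) (xj := Ind.yoneda.map g')).1 h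
  refine ⟨AsSmall.down.obj k, leOfHom (AsSmall.down.map p), Ind.yoneda.map_injective ?_⟩
  rw [Functor.map_comp, Functor.map_comp]
  exact hpq

/-- A morphism of inductive systems inducing an isomorphism of ind-objects: it is enough to have
inverses up to increasing the indices. -/
lemma isIso_indLim_map {X Y : ℕ ⥤ C} (β : X ⟶ Y)
    (h : ∀ n, ∃ m, ∃ hnm : n ≤ m, ∃ g : Y.obj n ⟶ X.obj m,
      β.app n ≫ g = X.map (homOfLE hnm) ∧ g ≫ β.app m = Y.map (homOfLE hnm)) :
    IsIso (indLim.map β) := by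
  choose m hm g hg hg' using h
  let t : ∀ n, Ind.yoneda.obj (Y.obj n) ⟶ indLim.obj X := fun n => Ind.yoneda.map (g n) ≫ indι X _
  -- `t n` can be computed from any later index, although the `g n` are not compatible
  have key : ∀ n k (hk : m n ≤ k),
      t n = Ind.yoneda.map (Y.map (homOfLE ((hm n).trans hk))) ≫ t k := by
    intro n k hk
    have h1 : g n ≫ X.map (homOfLE (hk.trans (hm k))) =
        Y.map (homOfLE ((hm n).trans hk)) ≫ g k := by
      rw [← homOfLE_comp hk (hm k), X.map_comp, ← hg k, ← Category.assoc (X.map _), β.naturality,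
        Category.assoc, ← Category.assoc, hg', ← Category.assoc, ← Y.map_comp, homOfLE_comp]
    simp only [t]
    rw [← Category.assoc, ← Functor.map_comp, ← h1, Functor.map_comp, Category.assoc, indι_w]
  have hcompat : ∀ {n n' : ℕ} (hnn : n ≤ n'),
      Ind.yoneda.map (Y.map (homOfLE hnn)) ≫ t n' = t n := by
    intro n n' hnn
    rw [key n (max (m n) (m n')) (le_max_left _ _), key n' (max (m n) (m n')) (le_max_right _ _),
      ← Category.assoc, ← Functor.map_comp, ← Functor.map_comp, homOfLE_comp]
  refine ⟨indDesc t hcompat, indLim_hom_ext fun n => ?_, indLim_hom_ext fun n => ?_⟩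
  · rw [← Category.assoc, indι_map, Category.assoc, indι_indDesc, ← Category.assoc,
      ← Functor.map_comp, hg, indι_w, Category.comp_id]
  · rw [← Category.assoc, indι_indDesc, Category.assoc, indι_map, ← Category.assoc,
      ← Functor.map_comp, hg', indι_w, Category.comp_id]

/-- The projective version of `isIso_indLim_map`. -/
lemma isIso_proLim_map {X Y : ℕᵒᵖ ⥤ C} (α : X ⟶ Y)
    (h : ∀ n, ∃ m, ∃ hnm : n ≤ m, ∃ g : Y.obj (op m) ⟶ X.obj (op n),
      α.app (op m) ≫ g = X.map (homOfLE hnm).op ∧ g ≫ α.app (op n) = Y.map (homOfLE hnm).op) :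
    IsIso (proLim.map α) := by
  have : IsIso (indLim.map (NatTrans.rightOp α)) := isIso_indLim_map _ fun n => by
    obtain ⟨m, hnm, g, h1, h2⟩ := h n
    exact ⟨m, hnm, g.op, congrArg Quiver.Hom.op h2, congrArg Quiver.Hom.op h1⟩
  exact inferInstanceAs (IsIso (indLim.map (NatTrans.rightOp α)).op)

/-- An isomorphism from a sequential ind-object to an object of `C` is given by a compatible family
of morphisms, one of which has a section through which all transition maps factor eventually. -/
lemma exists_section_of_iso {X : ℕ ⥤ C} {V : C} (e : indLim.obj X ≅ Ind.yoneda.obj V) :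
    ∃ n₀, ∃ f : V ⟶ X.obj n₀, f ≫ indComponent e.hom n₀ = 𝟙 V ∧
      ∀ n, ∃ m, ∃ (hnm : n ≤ m) (hm : n₀ ≤ m),
        indComponent e.hom n ≫ f ≫ X.map (homOfLE hm) = X.map (homOfLE hnm) := by
  have hcomp : ∀ n, Ind.yoneda.map (indComponent e.hom n) = indι X n ≫ e.hom :=
    fun n => Functor.map_preimage _ _
  obtain ⟨n₀, f, hf⟩ := exists_eq_comp_indι e.inv
  refine ⟨n₀, f, Ind.yoneda.map_injective ?_, fun n => ?_⟩
  · rw [Functor.map_comp, hcomp, ← Category.assoc, ← hf, e.inv_hom_id, CategoryTheory.Functor.map_id]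
  · have h1 : Ind.yoneda.map (indComponent e.hom n ≫ f ≫
        X.map (homOfLE (le_max_right n n₀))) ≫ indι X _ =
          Ind.yoneda.map (X.map (homOfLE (le_max_left n n₀))) ≫ indι X _ := by
      rw [indι_w, Functor.map_comp, Functor.map_comp, Category.assoc, Category.assoc, indι_w, ← hf,
        hcomp, Category.assoc, e.hom_inv_id, Category.comp_id]
    obtain ⟨m, hm, h2⟩ := exists_map_eq_of_comp_indι_eq h1
    refine ⟨m, (le_max_left n n₀).trans hm, (le_max_right n n₀).trans hm, ?_⟩
    simpa only [Category.assoc, ← X.map_comp, homOfLE_comp] using h2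

lemma indComponent_w {X : ℕ ⥤ C} {V : C} (e : indLim.obj X ⟶ Ind.yoneda.obj V) {n m : ℕ}
    (h : n ≤ m) : X.map (homOfLE h) ≫ indComponent e m = indComponent e n :=
  Ind.yoneda.map_injective (by
    simp only [indComponent, Functor.map_comp, Functor.map_preimage]
    rw [← Category.assoc, indι_w])

/-- The converse of `exists_section_of_iso`, for projective systems. -/
lemma exists_iso_proLim {Y : ℕᵒᵖ ⥤ C} {W : C} (c : ∀ n, W ⟶ Y.obj (op n))
    (hc : ∀ {n m : ℕ} (h : n ≤ m), c m ≫ Y.map (homOfLE h).op = c n) {n₀ : ℕ}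
    (f : Y.obj (op n₀) ⟶ W) (hf : c n₀ ≫ f = 𝟙 W)
    (h : ∀ n, ∃ m, ∃ (hnm : n ≤ m) (hm : n₀ ≤ m),
      Y.map (homOfLE hm).op ≫ f ≫ c n = Y.map (homOfLE hnm).op) :
    ∃ e : proConst.obj W ≅ proLim.obj Y, ∀ n, e.hom ≫ proπ Y n = proConst.map (c n) := by
  have hc' : ∀ {n m : ℕ} (hnm : n ≤ m), Ind.yoneda.map (Y.rightOp.map (homOfLE hnm)) ≫
      Ind.yoneda.map (c m).op = Ind.yoneda.map (c n).op := fun {n m} hnm => by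
    rw [← Functor.map_comp]
    exact congrArg (fun f => Ind.yoneda.map f) (congrArg Quiver.Hom.op (hc hnm))
  let i : indLim.obj Y.rightOp ≅ Ind.yoneda.obj (op W) :=
    { hom := indDesc (X := Y.rightOp) (fun n => Ind.yoneda.map (c n).op) hc'
      inv := Ind.yoneda.map f.op ≫ indι Y.rightOp n₀
      hom_inv_id := indLim_hom_ext fun n => by
        obtain ⟨m, hnm, hm, h1⟩ := h n
        have h2 : (c n).op ≫ f.op ≫ Y.rightOp.map (homOfLE hm) = Y.rightOp.map (homOfLE hnm) := by
          rw [← Category.assoc]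
          exact congrArg Quiver.Hom.op h1
        rw [← Category.assoc, indι_indDesc, ← indι_w Y.rightOp hm, Category.comp_id,
          ← Category.assoc, ← Category.assoc, ← Functor.map_comp, ← Functor.map_comp,
          Category.assoc, h2, indι_w]
      inv_hom_id := by
        rw [Category.assoc, indι_indDesc, ← Functor.map_comp, ← op_comp, hf, op_id,
          CategoryTheory.Functor.map_id] }
  refine ⟨i.op, fun n => ?_⟩
  exact congrArg Quiver.Hom.op (indι_indDesc (X := Y.rightOp) _ hc' n)

lemma proLim_map_proπ {X Y : ℕᵒᵖ ⥤ C} (α : X ⟶ Y) (n : ℕ) :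
    proLim.map α ≫ proπ Y n = proπ X n ≫ proConst.map (α.app (op n)) :=
  congrArg Quiver.Hom.op (indι_map (NatTrans.rightOp α) n)

end IndPro

/-! ### Cohomology of complexes of modules, in terms of elements -/

section Cohomology

variable {R : Type u} [CommRing R] (K : CochainComplex (ModuleCat.{u} R) ℤ)

lemma iCycles_injective (i : ℤ) : Function.Injective (K.iCycles i) :=
  (ModuleCat.mono_iff_injective _).1 inferInstance

lemma homologyπ_surjective (i : ℤ) : Function.Surjective (K.homologyπ i) :=
  (ModuleCat.epi_iff_surjective _).1 inferInstance

/-- The map from the kernel of the differential to the categorical cycles. -/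
def kerToCycles (i j : ℤ) (hij : i + 1 = j) :
    ModuleCat.of R (LinearMap.ker (K.d i j).hom) ⟶ K.cycles i :=
  K.liftCycles (ModuleCat.ofHom (LinearMap.ker (K.d i j).hom).subtype) j
    (by simp [← hij]) (by ext x; exact x.2)

lemma iCycles_kerToCycles (i j : ℤ) (hij : i + 1 = j) (x : LinearMap.ker (K.d i j).hom) :
    K.iCycles i (kerToCycles K i j hij x) = (x : K.X i) :=
  congrArg (fun f => f.hom x) (K.liftCycles_i (ModuleCat.ofHom
    (LinearMap.ker (K.d i j).hom).subtype) j (by simp [← hij]) (by ext x; exact x.2))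

lemma d_iCycles_apply (i j : ℤ) (z : K.cycles i) : K.d i j (K.iCycles i z) = 0 :=
  congrArg (fun f => f.hom z) (K.iCycles_d i j)

lemma homologyπ_eq_zero_iff (i j : ℤ) (hij : i + 1 = j) (z : K.cycles j) :
    K.homologyπ j z = 0 ↔ ∃ y : K.X i, K.iCycles j z = K.d i j y := by
  constructor
  · intro h
    have hex : (ShortComplex.mk _ _ (K.toCycles_comp_homologyπ i j)).Exact :=
      ShortComplex.exact_of_g_is_cokernel _ (K.homologyIsCokernel i j (by simp [← hij]))
    obtain ⟨y, hy⟩ := (ShortComplex.moduleCat_exact_iff _).1 hex z h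
    refine ⟨y, ?_⟩
    rw [← hy]
    exact congrArg (fun f => f.hom y) (K.toCycles_i i j)
  · rintro ⟨y, hy⟩
    have h1 : z = K.toCycles i j y := iCycles_injective K j (by
      rw [hy]; exact (congrArg (fun f => f.hom y) (K.toCycles_i i j)).symm)
    rw [h1]
    exact congrArg (fun f => f.hom y) (K.toCycles_comp_homologyπ i j)

/-- Linear forms on cohomology are determined by their values on classes of cocycles. -/
lemma homologyDual_ext {K : CochainComplex (ModuleCat.{u} R) ℤ} {i : ℤ}
    {l l' : Module.Dual R (K.homology i)} (h : ∀ x, l (K.homologyπ i x) = l' (K.homologyπ i x)) :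
    l = l' :=
  LinearMap.ext fun y => by
    obtain ⟨x, rfl⟩ := homologyπ_surjective K i y
    exact h x

lemma exists_form_on_homology (i j : ℤ) (hij : i + 1 = j)
    (ψ : LinearMap.ker (Module.Dual.transpose (K.d i j).hom)) :
    ∃ l : Module.Dual R (K.homology j), ∀ x, l (K.homologyπ j x) = ψ.1 (K.iCycles j x) := by
  let δ := K.descOpcycles (ModuleCat.ofHom ψ.1) i (by simp [← hij]) (ModuleCat.hom_ext ψ.2)
  refine ⟨(K.homologyι j ≫ δ).hom, fun x => ?_⟩
  have h : K.homologyπ j ≫ K.homologyι j ≫ δ = K.iCycles j ≫ ModuleCat.ofHom ψ.1 := by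
    rw [HomologicalComplex.homology_π_ι_assoc, HomologicalComplex.p_descOpcycles]
  exact congrArg (fun f => f.hom x) h

/-- A linear form vanishing on coboundaries induces a linear form on cohomology. -/
def formOnHomology (i j : ℤ) (hij : i + 1 = j) :
    LinearMap.ker (Module.Dual.transpose (K.d i j).hom) →ₗ[R] Module.Dual R (K.homology j) where
  toFun ψ := (exists_form_on_homology K i j hij ψ).choose
  map_add' ψ ψ' := homologyDual_ext fun x => by
    rw [LinearMap.add_apply, (exists_form_on_homology K i j hij ψ).choose_spec,
      (exists_form_on_homology K i j hij ψ').choose_spec,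
      (exists_form_on_homology K i j hij (ψ + ψ')).choose_spec]
    rfl
  map_smul' c ψ := homologyDual_ext fun x => by
    rw [LinearMap.smul_apply, (exists_form_on_homology K i j hij ψ).choose_spec,
      (exists_form_on_homology K i j hij (c • ψ)).choose_spec]
    rfl

lemma formOnHomology_homologyπ (i j : ℤ) (hij : i + 1 = j)
    (ψ : LinearMap.ker (Module.Dual.transpose (K.d i j).hom)) (x : K.cycles j) :
    formOnHomology K i j hij ψ (K.homologyπ j x) = ψ.1 (K.iCycles j x) :=
  (exists_form_on_homology K i j hij ψ).choose_spec x

/-- Morphisms out of the cohomology of a complex into the dual of the cohomology of another one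
are determined by the values of the forms attached to cocycles on cocycles. -/
lemma homologyHom_dual_ext {K L : CochainComplex (ModuleCat.{u} R) ℤ} {i j : ℤ}
    {f g : K.homology i ⟶ ModuleCat.of R (Module.Dual R (L.homology j))}
    (h : ∀ φ x, (show Module.Dual R _ from f (K.homologyπ i φ)) (L.homologyπ j x) =
      (show Module.Dual R _ from g (K.homologyπ i φ)) (L.homologyπ j x)) : f = g :=
  ModuleCat.hom_ext (LinearMap.ext fun y => by
    obtain ⟨φ, rfl⟩ := homologyπ_surjective K i y
    exact homologyDual_ext (h φ))

end Cohomology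

section FiniteRank

variable {k : Type u} [Field k]

lemma finite_range_comp {M V N : ModuleCat.{u} k} [Module.Finite k V] (e : M ⟶ V) (g : V ⟶ N) :
    Module.Finite k (LinearMap.range (e ≫ g).hom) := by
  rw [ModuleCat.hom_comp]
  exact Submodule.finiteDimensional_of_le (LinearMap.range_comp_le_range _ _)

variable {K L : CochainComplex (ModuleCat.{u} k) ℤ}

/-- If a morphism of complexes has finite rank in cohomology, the images of cocycles are
combinations, modulo coboundaries, of finitely many cocycles whose classes are independent. -/
lemma exists_cocycles_of_finite_rank (f : K ⟶ L) (i j l : ℤ) (hij : i + 1 = j) (hjl : j + 1 = l)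
    (hfin : Module.Finite k (LinearMap.range (HomologicalComplex.homologyMap f j).hom)) :
    ∃ (r : ℕ) (w : Fin r → L.X j), (∀ s, L.d j l (w s) = 0) ∧
      (∀ x, K.d j l x = 0 → ∃ (a : Fin r → k) (y : L.X i), f.f j x = ∑ s, a s • w s + L.d i j y) ∧
      ∀ (a : Fin r → k) (y : L.X i), ∑ s, a s • w s = L.d i j y → a = 0 := by
  let W := LinearMap.range (HomologicalComplex.homologyMap f j).hom
  let b := Module.finBasis k W
  choose z hz using fun s => homologyπ_surjective L j (b s : L.homology j)
  refine ⟨_, fun s => L.iCycles j (z s), fun s => d_iCycles_apply L j l _, fun x hx => ?_,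
    fun a y h => ?_⟩
  · let x' := kerToCycles K j l hjl ⟨x, hx⟩
    have hx' : K.iCycles j x' = x := iCycles_kerToCycles K j l hjl ⟨x, hx⟩
    let q : W := ⟨HomologicalComplex.homologyMap f j (K.homologyπ j x'), ⟨_, rfl⟩⟩
    have h0 : L.homologyπ j (HomologicalComplex.cyclesMap f j x' - ∑ s, b.repr q s • z s) = 0 := by
      have h1 : L.homologyπ j (HomologicalComplex.cyclesMap f j x') = (q : L.homology j) :=
        (congrArg (fun f => f.hom x') (HomologicalComplex.homologyπ_naturality f j)).symm
      have h2 : (q : L.homology j) = ∑ s, b.repr q s • (b s : L.homology j) := by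
        have h2 := congrArg W.subtype (b.sum_repr q)
        rw [map_sum] at h2
        exact h2.symm
      rw [map_sub, map_sum, h1, sub_eq_zero, h2]
      exact Finset.sum_congr rfl fun s _ => by rw [map_smul, hz]
    obtain ⟨y, hy⟩ := (homologyπ_eq_zero_iff L i j hij _).1 h0
    refine ⟨fun s => b.repr q s, y, ?_⟩
    have h3 : L.iCycles j (HomologicalComplex.cyclesMap f j x') = f.f j x := by
      conv_rhs => rw [← hx']
      exact congrArg (fun f => f.hom x') (HomologicalComplex.cyclesMap_i f j)
    rw [← hy, map_sub, h3, map_sum]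
    simp only [map_smul]
    abel
  · have h0 : L.homologyπ j (∑ s, a s • z s) = 0 :=
      (homologyπ_eq_zero_iff L i j hij _).2 ⟨y, by rw [← h, map_sum]; simp only [map_smul]⟩
    have h1 : ∑ s, a s • b s = 0 := by
      apply Subtype.ext
      rw [map_sum] at h0
      simp only [map_smul, hz] at h0
      simpa using h0
    exact funext (Fintype.linearIndependent_iff.1 b.linearIndependent a h1)

/-- Over a field, the class of a cocycle extends to a linear map on all cochains. -/
lemma exists_extend_homologyπ (K : CochainComplex (ModuleCat.{u} k) ℤ) (i : ℤ) :
    ∃ ρ : K.X i →ₗ[k] K.homology i, ∀ x, ρ (K.iCycles i x) = K.homologyπ i x := by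
  obtain ⟨g, hg⟩ := (K.iCycles i).hom.exists_leftInverse_of_injective
    (LinearMap.ker_eq_bot.2 (iCycles_injective K i))
  exact ⟨(K.homologyπ i).hom.comp g, fun x =>
    congrArg (K.homologyπ i).hom (congrArg (fun f => f x) hg)⟩

end FiniteRank

/-! ### Homotopies to finite rank morphisms -/

section FiniteRankHomotopy

open DFNModuleCat

variable {A : Type u} [Field A] [Algebra ℂ A] [Bornology A] {a b : ℤ}

/-- A linear map all of whose compositions with linear forms, bounded or not, are bounded. This
holds for finite rank maps `x ↦ ∑ j, ξ j x • w j` with bounded forms `ξ j`. -/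
def HasBoundedForms {E F : DFNModuleCat.{u} A} (f : E ⟶ F) : Prop :=
  ∀ φ : Module.Dual A F, IsBoundedMap (φ.comp (Hom.lin f))

lemma HasBoundedForms.comp {E F G : DFNModuleCat.{u} A} {f : E ⟶ F} (hf : HasBoundedForms f)
    (g : F ⟶ G) : HasBoundedForms (f ≫ g) := fun φ => hf (φ.comp (Hom.lin g))

lemma HasBoundedForms.precomp {E F G : DFNModuleCat.{u} A} {g : F ⟶ G} (hg : HasBoundedForms g)
    (f : E ⟶ F) : HasBoundedForms (f ≫ g) := fun φ =>
  IsBoundedMap.comp (g := φ.comp (Hom.lin g)) (f := Hom.lin f) (hg φ) (Hom.lin_bounded f)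

variable (E : ℕ ⥤ IntervalComplex (DFNModuleCat.{u} A) a b)

/-- The morphism of complexes from index `n` to a later index `m`. -/
abbrev transitionHom {n m : ℕ} (h : n ≤ m) : (E.obj n).obj ⟶ (E.obj m).obj :=
  (E.map (homOfLE h)).hom

lemma transitionHom_comp {n m l : ℕ} (h : n ≤ m) (h' : m ≤ l) :
    transitionHom E h ≫ transitionHom E h' = transitionHom E (h.trans h') := by
  rw [transitionHom, transitionHom, ← ObjectProperty.FullSubcategory.comp_hom, ← E.map_comp,
    homOfLE_comp]

/-- `exists_cocycles_of_finite_rank` for the underlying complexes of complexes of DFN-modules. -/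
lemma exists_cocycles_of_finite_rank_underlying {K L : CochainComplex (DFNModuleCat.{u} A) ℤ}
    (f : K ⟶ L) (i j l : ℤ) (hij : i + 1 = j) (hjl : j + 1 = l)
    (hfin : Module.Finite A (LinearMap.range
      (HomologicalComplex.homologyMap (underlyingComplex.map f) j).hom)) :
    ∃ (r : ℕ) (w : Fin r → L.X j), (∀ s, Hom.lin (L.d j l) (w s) = 0) ∧
      (∀ x, Hom.lin (K.d j l) x = 0 → ∃ (a : Fin r → A) (y : L.X i),
        Hom.lin (f.f j) x = ∑ s, a s • w s + Hom.lin (L.d i j) y) ∧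
      ∀ (a : Fin r → A) (y : L.X i), ∑ s, a s • w s = Hom.lin (L.d i j) y → a = 0 :=
  exists_cocycles_of_finite_rank (underlyingComplex.map f) i j l hij hjl hfin

/-- When the ind-object of cohomologies is a finite-dimensional vector space, transition maps to a
sufficiently late index have finite rank in cohomology. -/
lemma exists_finite_range_homologyMap {i : ℤ}
    (hfin : ∃ V : ModuleCat.{u} A, Module.Finite A V ∧
      Nonempty (indLim.obj (cohomologySystem E i) ≅ Ind.yoneda.obj V)) (n : ℕ) :
    ∃ m, ∃ h : n ≤ m, Module.Finite A (LinearMap.range (HomologicalComplex.homologyMap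
      (underlyingComplex.map (transitionHom E h)) i).hom) := by
  obtain ⟨V, hV, ⟨e⟩⟩ := hfin
  obtain ⟨n₀, f, -, hf⟩ := exists_section_of_iso e
  obtain ⟨m, hnm, hm, h⟩ := hf n
  refine ⟨m, hnm, ?_⟩
  have h1 := finite_range_comp (indComponent e.hom n) (f ≫ (cohomologySystem E i).map (homOfLE hm))
  rw [h] at h1
  exact h1

/-- Descending induction on the degree: for every `t` and from every index `n`, some transition
morphism is homotopic, in degrees `> b - t`, to maps `p i` which vanish on coboundaries, take
cocycles as values and make all linear forms bounded. The index `n` has to be arbitrary in the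
induction, since each step composes with the nuclear transition from `n` to `n + 1`. -/
lemma exists_partial_homotopy [DFNAlgebra A]
    (hnuc : ∀ (n : ℕ) (i : ℤ), IsNuclear A (transitionMap E n i))
    (hfin : ∀ i : ℤ, ∃ V : ModuleCat.{u} A, Module.Finite A V ∧
      Nonempty (indLim.obj (cohomologySystem E i) ≅ Ind.yoneda.obj V)) (t : ℕ) :
    ∀ n, ∃ m, ∃ hnm : n ≤ m, ∃ (p : ∀ i, (E.obj n).obj.X i ⟶ (E.obj m).obj.X i)
      (h : ∀ i j, (E.obj n).obj.X i ⟶ (E.obj m).obj.X j),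
      (∀ i j, (E.obj n).obj.d i j ≫ p j = 0) ∧ (∀ i j, p i ≫ (E.obj m).obj.d i j = 0) ∧
      (∀ i, HasBoundedForms (p i)) ∧
      ∀ i j l, i + 1 = j → j + 1 = l → b - t < j → (transitionHom E hnm).f j =
        h j i ≫ (E.obj m).obj.d i j + (E.obj n).obj.d j l ≫ h l j + p j := by
  induction t with
  | zero =>
    refine fun n => ⟨n, le_rfl, fun i => 0, fun i j => 0, by simp, by simp, fun i φ => ?_,
      fun i j l _ _ hj => ?_⟩
    · have : IsBoundedMap (fun _ : (E.obj n).obj.X i => (0 : A)) := isBoundedMap_const 0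
      convert this using 2
      exact map_zero φ
    · have := (E.obj n).property.2
      exact ((E.obj n).obj.isZero_of_isStrictlyLE b j (by simpa using hj)).eq_of_src _ _
  | succ t ih =>
    intro n
    obtain ⟨m, hnm, p, h, hdp, hpd, hp, hh⟩ := ih (n + 1)
    obtain ⟨m', hm', hfr⟩ := exists_finite_range_homologyMap E (hfin (b - t)) m
    have hnm' : n ≤ m' := n.le_succ.trans (hnm.trans hm')
    -- the degree of the new component of the homotopy, and its two neighbours
    obtain ⟨j, hj⟩ : ∃ j, j = b - t := ⟨_, rfl⟩
    obtain ⟨i, hij⟩ : ∃ i, i + 1 = j := ⟨j - 1, by lia⟩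
    obtain ⟨l, hjl⟩ : ∃ l, j + 1 = l := ⟨_, rfl⟩
    rw [← hj] at hfr
    let f := transitionHom E hm'
    obtain ⟨r, w, hw, hspan, hindep⟩ :=
      exists_cocycles_of_finite_rank_underlying f i j l hij hjl hfr
    let u := transitionHom E n.le_succ
    let v := (transitionHom E hnm).f j - (E.obj (n + 1)).obj.d j l ≫ h l j
    -- the part of the transition map not yet accounted for by the homotopy is a cocycle
    have hv : v ≫ (E.obj m).obj.d j l = 0 := by
      have h1 := hh j l (l + 1) hjl rfl (by lia)
      rw [Preadditive.sub_comp, (transitionHom E hnm).comm, h1, Preadditive.comp_add,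
        Preadditive.comp_add, hdp, Category.assoc]
      simp
    obtain ⟨ξ, η, hξ, hη, hrel⟩ := exists_finite_rank_add_lift (hnuc n j) (Hom.lin_bounded v)
      (Hom.lin_bounded ((E.obj m).obj.d j l))
      (fun x => congrArg (fun g => Hom.lin g x) hv) (Hom.lin_bounded (f.f j))
      (Hom.lin_bounded ((E.obj m').obj.d i j)) w hspan
    have hu : transitionHom E hnm' = u ≫ transitionHom E hnm ≫ f := by
      rw [transitionHom_comp, transitionHom_comp]
    let η' : (E.obj n).obj.X j ⟶ (E.obj m').obj.X i := ⟨η, hη⟩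
    have hwξ : ∀ x, (∑ s, (ξ s).smulRight (w s)) x = ∑ s, ξ s x • w s := fun x => by
      simp [LinearMap.sum_apply]
    let q : (E.obj n).obj.X j ⟶ (E.obj m').obj.X j := ⟨∑ s, (ξ s).smulRight (w s), by
      have h1 : ∀ s, IsBoundedMap fun x => ξ s x • w s := fun s =>
        (BornologicalModule.isBoundedMap_smul (w s)).comp (hξ s)
      change IsBoundedMap _
      rw [show ⇑(∑ s, (ξ s).smulRight (w s)) = fun x => ∑ s, ξ s x • w s from funext hwξ]
      exact IsBoundedMap.sum Finset.univ h1⟩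
    have hq : ∀ x, Hom.lin q x = ∑ s, ξ s x • w s := hwξ
    have hrel' : u.f j ≫ v ≫ f.f j = η' ≫ (E.obj m').obj.d i j + q := by
      refine Hom.ext_lin (LinearMap.ext fun x => ?_)
      refine (hrel x).trans ?_
      rw [← hq, add_comm]
      rfl
    have hj' : (transitionHom E hnm').f j = η' ≫ (E.obj m').obj.d i j +
        (E.obj n).obj.d j l ≫ u.f l ≫ h l j ≫ f.f j + q := by
      have h1 : (transitionHom E hnm).f j = v + (E.obj (n + 1)).obj.d j l ≫ h l j := by
        simp [v]
      rw [hu, HomologicalComplex.comp_f, HomologicalComplex.comp_f, h1, Preadditive.add_comp,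
        Preadditive.comp_add, hrel', Category.assoc, u.comm_assoc]
      abel
    have hqd : q ≫ (E.obj m').obj.d j l = 0 := by
      refine Hom.ext_lin (LinearMap.ext fun x => ?_)
      change Hom.lin ((E.obj m').obj.d j l) (Hom.lin q x) = 0
      rw [hq, map_sum]
      refine Finset.sum_eq_zero fun s _ => ?_
      rw [map_smul]
      exact (congrArg _ (hw s)).trans (smul_zero _)
    -- the forms `ξ s` vanish on coboundaries since the classes of the `w s` are independent
    have hdq : (E.obj n).obj.d i j ≫ q = 0 := by
      have h1 : (E.obj n).obj.d i j ≫ q = ((transitionHom E hnm').f i -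
          (E.obj n).obj.d i j ≫ η') ≫ (E.obj m').obj.d i j := by
        rw [Preadditive.sub_comp, (transitionHom E hnm').comm, hj']
        simp
      refine Hom.ext_lin (LinearMap.ext fun x => ?_)
      have h2 := congrArg (fun g => Hom.lin g x) h1
      change Hom.lin q (Hom.lin ((E.obj n).obj.d i j) x) = _ at h2
      change Hom.lin q (Hom.lin ((E.obj n).obj.d i j) x) = 0
      rw [hq] at h2 ⊢
      have h3 := hindep _ _ h2
      exact Finset.sum_eq_zero fun s _ => by rw [congrFun h3 s]; exact zero_smul A _
    refine ⟨m', hnm', Function.update (fun i => u.f i ≫ p i ≫ f.f i) j q,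
      Function.update (fun i i' => u.f i ≫ h i i' ≫ f.f i') j (Function.update (fun _ => 0) i η'),
      fun i' j' => ?_, fun j' l' => ?_, fun j' => ?_, fun i' j' l' hij' hjl' hlt => ?_⟩
    · by_cases hjj : j' = j
      · subst hjj
        rw [Function.update_self]
        by_cases hii : i' = i
        · subst hii; exact hdq
        · rw [(E.obj n).obj.shape i' j' (by simp; lia), Limits.zero_comp]
      · rw [Function.update_of_ne hjj, ← u.comm_assoc, ← Category.assoc (HomologicalComplex.d _ _ _),
          hdp, Limits.zero_comp, Limits.comp_zero]
    · by_cases hjj : j' = j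
      · subst hjj
        rw [Function.update_self]
        by_cases hll : l' = l
        · subst hll; exact hqd
        · rw [(E.obj m').obj.shape j' l' (by simp; lia), Limits.comp_zero]
      · rw [Function.update_of_ne hjj, Category.assoc, Category.assoc, f.comm,
          ← Category.assoc (p j'), hpd, Limits.zero_comp, Limits.comp_zero]
    · by_cases hjj : j' = j
      · subst hjj
        rw [Function.update_self]
        intro φ
        have h1 : ∀ s, IsBoundedMap fun x => ξ s x • φ (w s) := fun s =>
          (BornologicalModule.isBoundedMap_smul (φ (w s))).comp (hξ s)
        have h2 := IsBoundedMap.sum Finset.univ h1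
        convert h2 using 2 with x
        change φ (Hom.lin q x) = _
        rw [hq, map_sum]
        simp only [map_smul]
      · rw [Function.update_of_ne hjj]
        exact ((hp j').comp _).precomp _
    · by_cases hjj : j' = j
      · subst hjj
        obtain rfl : i' = i := by lia
        obtain rfl : l' = l := by lia
        rw [Function.update_self, Function.update_self, Function.update_self,
          Function.update_of_ne (by lia), hj']
      · rw [Function.update_of_ne hjj, Function.update_of_ne hjj, Function.update_of_ne (by lia),
          hu, HomologicalComplex.comp_f, HomologicalComplex.comp_f,
          hh i' j' l' hij' hjl' (by push_cast at hlt; lia)]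
        simp only [Preadditive.add_comp, Preadditive.comp_add, Category.assoc, f.comm,
          u.comm_assoc]

/-- Transition morphisms of late index are homotopic, through bounded homotopies, to morphisms
with values in cocycles, along which all linear forms become bounded. -/
lemma exists_homotopy_hasBoundedForms [DFNAlgebra A]
    (hnuc : ∀ (n : ℕ) (i : ℤ), IsNuclear A (transitionMap E n i))
    (hfin : ∀ i : ℤ, ∃ V : ModuleCat.{u} A, Module.Finite A V ∧
      Nonempty (indLim.obj (cohomologySystem E i) ≅ Ind.yoneda.obj V)) (n : ℕ) :
    ∃ m, ∃ hnm : n ≤ m, ∃ P : (E.obj n).obj ⟶ (E.obj m).obj,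
      Nonempty (Homotopy (transitionHom E hnm) P) ∧ (∀ i, HasBoundedForms (P.f i)) ∧
        ∀ i j, P.f i ≫ (E.obj m).obj.d i j = 0 := by
  obtain ⟨m, hnm, p, h, hdp, hpd, hp, hh⟩ :=
    exists_partial_homotopy E hnuc hfin (b - a + 1).toNat n
  have hh' : ∀ i j l, i + 1 = j → j + 1 = l → (transitionHom E hnm).f j =
      h j i ≫ (E.obj m).obj.d i j + (E.obj n).obj.d j l ≫ h l j + p j := by
    intro i j l hij hjl
    by_cases hj : b - ((b - a + 1).toNat : ℤ) < j
    · exact hh i j l hij hjl hj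
    · have := (E.obj n).property.1
      exact ((E.obj n).obj.isZero_of_isStrictlyGE a j (by lia)).eq_of_src _ _
  let P : (E.obj n).obj ⟶ (E.obj m).obj := { f := p, comm' := fun i j _ => by rw [hdp, hpd] }
  refine ⟨m, hnm, P, ⟨{ hom := fun i j => if j + 1 = i then h i j else 0, zero := ?_, comm := ?_ }⟩,
    hp, hpd⟩
  · intro i j hij
    exact if_neg hij
  · intro i
    rw [dNext_eq _ (show (ComplexShape.up ℤ).Rel i (i + 1) from rfl),
      prevD_eq _ (show (ComplexShape.up ℤ).Rel (i - 1) i from sub_add_cancel i 1),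
      if_pos rfl, if_pos (sub_add_cancel i 1), hh' (i - 1) i (i + 1) (sub_add_cancel i 1) rfl]
    rw [add_comm (h i (i - 1) ≫ _)]

end FiniteRankHomotopy

/-! ### Dual complexes -/

section DualComplex

open DFNModuleCat

/-- Contravariant additive functors preserve homotopies. -/
def dualComplexHomotopy {C : Type v} [Category.{w} C] [Preadditive C] {D : Type*} [Category* D]
    [Preadditive D] (T : Cᵒᵖ ⥤ D) [T.Additive] {K L : CochainComplex C ℤ} {f g : K ⟶ L}
    (h : Homotopy f g) : Homotopy ((dualComplex T).map f.op) ((dualComplex T).map g.op) :=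
  T.mapHomotopy (CochainComplex.homotopyOp h)

variable {A : Type u} [Field A] [Algebra ℂ A] [Bornology A] [DFNAlgebra A]

/-- The inclusion of the bornological dual of a complex into its algebraic dual. -/
abbrev dualComplexInclusion (K : CochainComplex (DFNModuleCat.{u} A) ℤ) :
    (dualComplex (bornologicalDual A)).obj (op K) ⟶ (dualComplex (algebraicDual A)).obj (op K) :=
  (NatTrans.mapHomologicalComplex (dualInclusion A) (ComplexShape.up ℤ)).app
    ((CochainComplex.opEquivalence _).functor.obj (op K))

/-- Composition with a map which makes all forms bounded, from the algebraic dual to the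
bornological dual. -/
def HasBoundedForms.dualMap {E F : DFNModuleCat.{u} A} {f : E ⟶ F} (hf : HasBoundedForms f) :
    Module.Dual A F →ₗ[A] boundedHom A E A :=
  (Module.Dual.transpose (Hom.lin f)).codRestrict (boundedHom A E A) hf

/-- `HasBoundedForms.dualMap` for complexes. This is the inverse, up to homotopy and up to raising
the index, of the inclusion of the bornological duals into the algebraic duals. -/
def dualFactor {K L : CochainComplex (DFNModuleCat.{u} A) ℤ} (P : K ⟶ L)
    (hP : ∀ i, HasBoundedForms (P.f i)) :
    (dualComplex (algebraicDual A)).obj (op L) ⟶ (dualComplex (bornologicalDual A)).obj (op K) where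
  f i := ModuleCat.ofHom (hP (-i)).dualMap
  comm' i j _ := by
    refine ModuleCat.hom_ext (LinearMap.ext fun (φ : Module.Dual A (L.X (-i))) =>
      Subtype.ext (LinearMap.ext fun x => ?_))
    change φ (Hom.lin (P.f (-i)) (Hom.lin (K.d (-j) (-i)) x)) =
      φ (Hom.lin (L.d (-j) (-i)) (Hom.lin (P.f (-j)) x))
    exact congrArg (fun g => φ (Hom.lin g x)) (P.comm (-j) (-i)).symm

lemma dualFactor_comp_inclusion {K L : CochainComplex (DFNModuleCat.{u} A) ℤ} (P : K ⟶ L)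
    (hP : ∀ i, HasBoundedForms (P.f i)) :
    dualFactor P hP ≫ dualComplexInclusion K = (dualComplex (algebraicDual A)).map P.op := rfl

lemma inclusion_comp_dualFactor {K L : CochainComplex (DFNModuleCat.{u} A) ℤ} (P : K ⟶ L)
    (hP : ∀ i, HasBoundedForms (P.f i)) :
    dualComplexInclusion L ≫ dualFactor P hP = (dualComplex (bornologicalDual A)).map P.op := rfl

variable {a b : ℤ} (E : ℕ ⥤ IntervalComplex (DFNModuleCat.{u} A) a b)

/-- The bornological and algebraic duals of the system define the same pro-object up to
homotopy. -/
lemma isIso_proLim_map_dualInclusion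
    (hnuc : ∀ (n : ℕ) (i : ℤ), IsNuclear A (transitionMap E n i))
    (hfin : ∀ i : ℤ, ∃ V : ModuleCat.{u} A, Module.Finite A V ∧
      Nonempty (indLim.obj (cohomologySystem E i) ≅ Ind.yoneda.obj V)) :
    IsIso (proLim.map (Functor.whiskerLeft E.op (dualKbMap (dualInclusion A) a b))) := by
  refine isIso_proLim_map _ fun n => ?_
  obtain ⟨m, hnm, P, ⟨H⟩, hP, -⟩ := exists_homotopy_hasBoundedForms E hnuc hfin n
  refine ⟨m, hnm, ObjectProperty.homMk ((HomotopyCategory.quotient _ _).map (dualFactor P hP)),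
    ObjectProperty.hom_ext _ ?_, ObjectProperty.hom_ext _ ?_⟩
  · change (HomotopyCategory.quotient _ _).map (dualComplexInclusion (E.obj m).obj) ≫
      (HomotopyCategory.quotient _ _).map (dualFactor P hP) =
        (HomotopyCategory.quotient _ _).map
          ((dualComplex (bornologicalDual A)).map (transitionHom E hnm).op)
    rw [← Functor.map_comp, inclusion_comp_dualFactor]
    exact (HomotopyCategory.eq_of_homotopy _ _ (dualComplexHomotopy _ H)).symm
  · change (HomotopyCategory.quotient _ _).map (dualFactor P hP) ≫
      (HomotopyCategory.quotient _ _).map (dualComplexInclusion (E.obj n).obj) =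
        (HomotopyCategory.quotient _ _).map
          ((dualComplex (algebraicDual A)).map (transitionHom E hnm).op)
    rw [← Functor.map_comp, dualFactor_comp_inclusion]
    exact (HomotopyCategory.eq_of_homotopy _ _ (dualComplexHomotopy _ H)).symm

variable (K : CochainComplex (DFNModuleCat.{u} A) ℤ)

/-- The linear form underlying a cocycle of the bornological dual. -/
def cocycleForm (i : ℤ) : ((dualComplex (bornologicalDual A)).obj (op K)).cycles i →ₗ[A]
    Module.Dual A (K.X (-i)) :=
  (boundedHom A (K.X (-i)) A).subtype.comp
    (((dualComplex (bornologicalDual A)).obj (op K)).iCycles i).hom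

lemma cocycleForm_mem_ker (i : ℤ) (φ : ((dualComplex (bornologicalDual A)).obj (op K)).cycles i) :
    cocycleForm K i φ ∈ LinearMap.ker
      (Module.Dual.transpose (((underlyingComplex.obj K).d (-(i + 1)) (-i)).hom)) :=
  congrArg Subtype.val
    (d_iCycles_apply ((dualComplex (bornologicalDual A)).obj (op K)) i (i + 1) φ)

/-- The pairing between cocycles of the bornological dual and cohomology. -/
def cyclesPairing (i : ℤ) : ((dualComplex (bornologicalDual A)).obj (op K)).cycles i ⟶
    ModuleCat.of A (Module.Dual A ((underlyingComplex.obj K).homology (-i))) :=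
  ModuleCat.ofHom ((formOnHomology (underlyingComplex.obj K) (-(i + 1)) (-i) (by lia)).comp
    ((cocycleForm K i).codRestrict _ (cocycleForm_mem_ker K i)))

lemma cyclesPairing_apply (i : ℤ) (φ : ((dualComplex (bornologicalDual A)).obj (op K)).cycles i)
    (x : (underlyingComplex.obj K).cycles (-i)) :
    (show Module.Dual A _ from cyclesPairing K i φ)
      ((underlyingComplex.obj K).homologyπ (-i) x) = evalCocycles K i φ x :=
  formOnHomology_homologyπ (underlyingComplex.obj K) (-(i + 1)) (-i) (by lia) _ x

lemma toCycles_cyclesPairing (i : ℤ) :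
    (((dualComplex (bornologicalDual A)).obj (op K)).sc i).toCycles ≫ cyclesPairing K i = 0 := by
  refine ModuleCat.hom_ext (LinearMap.ext fun y => homologyDual_ext fun x => ?_)
  refine (cyclesPairing_apply K i _ x).trans ?_
  have h1 := congrArg (fun f => f.hom y)
    (((dualComplex (bornologicalDual A)).obj (op K)).sc i).toCycles_i
  have h2 := d_iCycles_apply (underlyingComplex.obj K) (-i) (-((ComplexShape.up ℤ).prev i)) x
  refine (congrArg (fun l : boundedHom A (K.X (-i)) A =>
    l.1 ((underlyingComplex.obj K).iCycles (-i) x)) h1).trans ?_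
  exact (congrArg (show boundedHom A (K.X (-((ComplexShape.up ℤ).prev i))) A from y).1 h2).trans
    (map_zero _)

/-- The pairing between the cohomology of the bornological dual and cohomology. -/
def homologyPairing (i : ℤ) : ((dualComplex (bornologicalDual A)).obj (op K)).homology i ⟶
    ModuleCat.of A (Module.Dual A ((underlyingComplex.obj K).homology (-i))) :=
  (((dualComplex (bornologicalDual A)).obj (op K)).sc i).descHomology (cyclesPairing K i)
    (toCycles_cyclesPairing K i)

lemma homologyπ_homologyPairing (i : ℤ) :
    ((dualComplex (bornologicalDual A)).obj (op K)).homologyπ i ≫ homologyPairing K i =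
      cyclesPairing K i :=
  ShortComplex.π_descHomology _ _ _

lemma homologyPairing_apply (i : ℤ) (φ : ((dualComplex (bornologicalDual A)).obj (op K)).cycles i)
    (x : (underlyingComplex.obj K).cycles (-i)) :
    (show Module.Dual A _ from homologyPairing K i
      (((dualComplex (bornologicalDual A)).obj (op K)).homologyπ i φ))
        ((underlyingComplex.obj K).homologyπ (-i) x) = evalCocycles K i φ x := by
  have h := congrArg (fun f => f.hom φ) (homologyπ_homologyPairing K i)
  exact (congrArg (fun l : Module.Dual A _ => l ((underlyingComplex.obj K).homologyπ (-i) x)) h).trans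
    (cyclesPairing_apply K i φ x)

lemma evalCocycles_cyclesMap {K L : CochainComplex (DFNModuleCat.{u} A) ℤ} (f : K ⟶ L) (i : ℤ)
    (φ : ((dualComplex (bornologicalDual A)).obj (op L)).cycles i)
    (x : (underlyingComplex.obj K).cycles (-i)) :
    evalCocycles K i (HomologicalComplex.cyclesMap ((dualComplex (bornologicalDual A)).map f.op) i φ)
      x = evalCocycles L i φ (HomologicalComplex.cyclesMap (underlyingComplex.map f) (-i) x) := by
  have h1 := congrArg (fun g => g.hom φ)
    (HomologicalComplex.cyclesMap_i ((dualComplex (bornologicalDual A)).map f.op) i)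
  have h2 := congrArg (fun g => g.hom x)
    (HomologicalComplex.cyclesMap_i (underlyingComplex.map f) (-i))
  refine (congrArg (fun l : boundedHom A (K.X (-i)) A =>
    l.1 ((underlyingComplex.obj K).iCycles (-i) x)) h1).trans ?_
  exact (congrArg (show boundedHom A (L.X (-i)) A from
    ((dualComplex (bornologicalDual A)).obj (op L)).iCycles i φ).1 h2).symm

lemma homologyPairing_naturality {K L : CochainComplex (DFNModuleCat.{u} A) ℤ} (f : K ⟶ L)
    (i : ℤ) :
    HomologicalComplex.homologyMap ((dualComplex (bornologicalDual A)).map f.op) i ≫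
      homologyPairing K i = homologyPairing L i ≫ (moduleDual A).map
        (HomologicalComplex.homologyMap (underlyingComplex.map f) (-i)).op := by
  refine homologyHom_dual_ext fun φ x => ?_
  have h1 := congrArg (fun g => g.hom φ)
    (HomologicalComplex.homologyπ_naturality ((dualComplex (bornologicalDual A)).map f.op) i)
  have h2 := congrArg (fun g => g.hom x)
    (HomologicalComplex.homologyπ_naturality (underlyingComplex.map f) (-i))
  refine (congrArg (fun y => (show Module.Dual A _ from homologyPairing K i y)
    ((underlyingComplex.obj K).homologyπ (-i) x)) h1).trans ?_
  refine (homologyPairing_apply K i _ x).trans ((evalCocycles_cyclesMap f i φ x).trans ?_)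
  refine (homologyPairing_apply L i φ _).symm.trans ?_
  exact (congrArg (show Module.Dual A _ from homologyPairing L i
    (((dualComplex (bornologicalDual A)).obj (op L)).homologyπ i φ)) h2).symm

/-- The pairing between cohomology of the bornological duals and cohomology, for a system. -/
def systemPairing (i : ℤ) :
    dualCohomologySystem E i ⟶ (cohomologySystem E (-i)).op ⋙ moduleDual A where
  app n := homologyPairing (E.obj n.unop).obj i
  naturality _ _ f := homologyPairing_naturality (E.map f.unop).hom i

/-- A morphism of complexes with values in cocycles, along which all forms become bounded, turns
forms on cohomology into classes of bounded cocycles. -/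
lemma exists_homologyDual_factor {K L : CochainComplex (DFNModuleCat.{u} A) ℤ} (P : K ⟶ L)
    (hP : ∀ i, HasBoundedForms (P.f i)) (hPd : ∀ i j, P.f i ≫ L.d i j = 0) (i : ℤ) :
    ∃ g : ModuleCat.of A (Module.Dual A ((underlyingComplex.obj L).homology (-i))) ⟶
        ((dualComplex (bornologicalDual A)).obj (op K)).homology i,
      homologyPairing L i ≫ g =
        HomologicalComplex.homologyMap ((dualComplex (bornologicalDual A)).map P.op) i ∧
      g ≫ homologyPairing K i = (moduleDual A).map
        (HomologicalComplex.homologyMap (underlyingComplex.map P) (-i)).op := by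
  obtain ⟨ρ, hρ⟩ := exists_extend_homologyπ (underlyingComplex.obj L) (-i)
  -- `c l` is the form `l ∘ ρ ∘ P`, a bounded cocycle
  let c : ModuleCat.of A (Module.Dual A ((underlyingComplex.obj L).homology (-i))) ⟶
      ((dualComplex (bornologicalDual A)).obj (op K)).X i :=
    ModuleCat.ofHom ((hP (-i)).dualMap.comp (Module.Dual.transpose ρ))
  have hc : c ≫ ((dualComplex (bornologicalDual A)).obj (op K)).d i (i + 1) = 0 := by
    refine ModuleCat.hom_ext (LinearMap.ext fun (l : Module.Dual A _) =>
      Subtype.ext (LinearMap.ext fun x => ?_))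
    change l (ρ (Hom.lin (P.f (-i)) (Hom.lin (K.d (-(i + 1)) (-i)) x))) = 0
    have h1 : K.d (-(i + 1)) (-i) ≫ P.f (-i) = 0 := by rw [← P.comm, hPd]
    have h2 : Hom.lin (P.f (-i)) (Hom.lin (K.d (-(i + 1)) (-i)) x) = 0 :=
      congrArg (fun f => Hom.lin f x) h1
    rw [h2]
    exact (congrArg l (map_zero ρ)).trans (map_zero l)
  let s := ((dualComplex (bornologicalDual A)).obj (op K)).liftCycles c (i + 1) (by simp) hc
  have hs : s ≫ ((dualComplex (bornologicalDual A)).obj (op K)).iCycles i = c :=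
    HomologicalComplex.liftCycles_i _ _ _ _ _
  refine ⟨s ≫ HomologicalComplex.homologyπ _ i, ?_, ?_⟩
  · have h1 : cyclesPairing L i ≫ s =
        HomologicalComplex.cyclesMap ((dualComplex (bornologicalDual A)).map P.op) i := by
      rw [← cancel_mono (HomologicalComplex.iCycles _ i), Category.assoc, hs,
        HomologicalComplex.cyclesMap_i]
      refine ModuleCat.hom_ext (LinearMap.ext fun φ => Subtype.ext (LinearMap.ext fun x => ?_))
      -- all values of `P` are cocycles, so that the choice of `ρ` does not matter
      have hx : (underlyingComplex.obj L).d (-i) (-i + 1) (Hom.lin (P.f (-i)) x) = 0 :=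
        congrArg (fun f => Hom.lin f x) (hPd (-i) (-i + 1))
      let z := kerToCycles (underlyingComplex.obj L) (-i) (-i + 1) rfl ⟨_, hx⟩
      have hz : (underlyingComplex.obj L).iCycles (-i) z = Hom.lin (P.f (-i)) x :=
        iCycles_kerToCycles (underlyingComplex.obj L) (-i) (-i + 1) rfl ⟨_, hx⟩
      change (show Module.Dual A _ from cyclesPairing L i φ) (ρ (Hom.lin (P.f (-i)) x)) =
        cocycleForm L i φ (Hom.lin (P.f (-i)) x)
      rw [← hz]
      exact (congrArg (show Module.Dual A _ from cyclesPairing L i φ) (hρ z)).trans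
        (cyclesPairing_apply L i φ z)
    rw [← cancel_epi (HomologicalComplex.homologyπ _ i), HomologicalComplex.homologyπ_naturality,
      ← Category.assoc, ← Category.assoc, homologyπ_homologyPairing, h1]
  · refine ModuleCat.hom_ext (LinearMap.ext fun (l : Module.Dual A _) =>
      homologyDual_ext fun x => ?_)
    refine (homologyPairing_apply K i (s l) x).trans ?_
    have h1 := congrArg (fun g => g.hom l) hs
    have h2 := congrArg (fun g => g.hom x)
      (HomologicalComplex.cyclesMap_i (underlyingComplex.map P) (-i))
    have h3 := congrArg (fun g => g.hom x)
      (HomologicalComplex.homologyπ_naturality (underlyingComplex.map P) (-i))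
    refine (congrArg (fun l : boundedHom A (K.X (-i)) A =>
      l.1 ((underlyingComplex.obj K).iCycles (-i) x)) h1).trans ?_
    refine Eq.trans ?_ (congrArg l h3).symm
    refine Eq.trans ?_ (congrArg l (hρ _))
    exact (congrArg (fun y => l (ρ y)) h2).symm

/-- The pairing between cohomology of the bornological duals and cohomology is perfect at the level
of pro-objects. -/
lemma isIso_proLim_map_systemPairing
    (hnuc : ∀ (n : ℕ) (i : ℤ), IsNuclear A (transitionMap E n i))
    (hfin : ∀ i : ℤ, ∃ V : ModuleCat.{u} A, Module.Finite A V ∧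
      Nonempty (indLim.obj (cohomologySystem E i) ≅ Ind.yoneda.obj V)) (i : ℤ) :
    IsIso (proLim.map (systemPairing E i)) := by
  refine isIso_proLim_map _ fun n => ?_
  obtain ⟨m, hnm, P, ⟨H⟩, hP, hPd⟩ := exists_homotopy_hasBoundedForms E hnuc hfin n
  obtain ⟨g, h1, h2⟩ := exists_homologyDual_factor P hP hPd i
  refine ⟨m, hnm, g, h1.trans ?_, h2.trans ?_⟩
  · have h3 := (dualComplexHomotopy (bornologicalDual A) H).homologyMap_eq i
    exact h3.symm
  · have h3 : HomologicalComplex.homologyMap (underlyingComplex.map (transitionHom E hnm)) (-i) =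
        HomologicalComplex.homologyMap (underlyingComplex.map P) (-i) :=
      ((forgetBornology A).mapHomotopy H).homologyMap_eq (-i)
    rw [← h3]
    rfl

/-- If a system of modules is isomorphic to `V` as an ind-object, the system of its duals is
isomorphic to the dual of `V` as a pro-object. -/
lemma exists_iso_proLim_dual {k : Type u} [CommRing k] {X : ℕ ⥤ ModuleCat.{u} k}
    {V : ModuleCat.{u} k}
    (e : indLim.obj X ≅ Ind.yoneda.obj V) :
    ∃ e' : proConst.obj (ModuleCat.of k (Module.Dual k V)) ≅ proLim.obj (X.op ⋙ moduleDual k),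
      ∀ n, e'.hom ≫ proπ (X.op ⋙ moduleDual k) n =
        proConst.map ((moduleDual k).map (indComponent e.hom n).op) := by
  obtain ⟨n₀, f, hf, h⟩ := exists_section_of_iso e
  refine exists_iso_proLim (Y := X.op ⋙ moduleDual k)
    (fun n => (moduleDual k).map (indComponent e.hom n).op) (fun {n m} hnm => ?_)
    ((moduleDual k).map f.op) ?_ fun n => ?_
  · change (moduleDual k).map _ ≫ (moduleDual k).map (X.map (homOfLE hnm)).op = _
    rw [← Functor.map_comp, ← op_comp, indComponent_w]
  · change (moduleDual k).map _ ≫ (moduleDual k).map f.op = _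
    rw [← Functor.map_comp, ← op_comp, hf]
    rfl
  · obtain ⟨m, hnm, hm, h1⟩ := h n
    refine ⟨m, hnm, hm, ?_⟩
    change (moduleDual k).map (X.map (homOfLE hm)).op ≫ (moduleDual k).map _ ≫
      (moduleDual k).map _ = (moduleDual k).map (X.map (homOfLE hnm)).op
    rw [← Functor.map_comp, ← Functor.map_comp, ← op_comp, ← op_comp, Category.assoc, h1]

end DualComplex

end

theorem theorem4p6 {A : Type u} [Field A] [Algebra ℂ A] [Bornology A] [DFNAlgebra A]
    (a b : ℤ) (hab : a ≤ b)
    (E : ℕ ⥤ IntervalComplex (DFNModuleCat.{u} A) a b)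
    (hnuc : ∀ (n : ℕ) (i : ℤ), IsNuclear A (transitionMap E n i))
    (hfin : ∀ i : ℤ, ∃ V : ModuleCat.{u} A, Module.Finite A V ∧
      Nonempty (indLim.obj (cohomologySystem E i) ≅ Ind.yoneda.obj V)) :
    -- the inclusions `E_n^∨ ⊆ Hom_A(E_n, A)` induce an isomorphism in `Pro(K^b(Mod A))`
    IsIso (proLim.map (Functor.whiskerLeft E.op (dualKbMap (dualInclusion A) a b))) ∧
    -- `"colim" H^{-i}(E_n) ≅ V` and `"lim" H^i(E_n^∨) ≅ Hom_A(V, A)` with `V` finite-dimensional,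
    -- and the resulting pairing is evaluation of linear forms on cocycles
    ∀ i : ℤ, ∃ V : ModuleCat.{u} A, Module.Finite A V ∧
      ∃ (e : indLim.obj (cohomologySystem E (-i)) ≅ Ind.yoneda.obj V)
        (e' : proConst.obj (ModuleCat.of A (Module.Dual A V)) ≅
          proLim.obj (dualCohomologySystem E i)),
        ∀ (n : ℕ) (l : Module.Dual A V)
          (φ : ((dualComplex (bornologicalDual A)).obj (op (E.obj n).obj)).cycles i)
          (x : (underlyingComplex.obj (E.obj n).obj).cycles (-i)),
          ((dualComplex (bornologicalDual A)).obj (op (E.obj n).obj)).homologyπ i φ =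
              (proComponent e'.hom n).hom l →
            evalCocycles (E.obj n).obj i φ x =
              l ((indComponent e.hom n).hom
                ((underlyingComplex.obj (E.obj n).obj).homologyπ (-i) x)) := by
  refine ⟨isIso_proLim_map_dualInclusion E hnuc hfin, fun i => ?_⟩
  obtain ⟨V, hV, ⟨e⟩⟩ := hfin (-i)
  obtain ⟨e₁, he₁⟩ := exists_iso_proLim_dual e
  have : IsIso (proLim.map (systemPairing E i)) := isIso_proLim_map_systemPairing E hnuc hfin i
  let e' := e₁ ≪≫ (asIso (proLim.map (systemPairing E i))).symm
  refine ⟨V, hV, e, e', fun n l φ x hφ => ?_⟩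
  have h : proComponent e'.hom n ≫ (systemPairing E i).app (op n) =
      (moduleDual A).map (indComponent e.hom n).op := by
    apply proConst.map_injective
    refine Eq.trans ?_ (he₁ n)
    rw [Functor.map_comp, proComponent, Functor.map_preimage, Category.assoc, ← proLim_map_proπ,
      ← Category.assoc]
    simp [e']
  refine (homologyPairing_apply (E.obj n).obj i φ x).symm.trans ?_
  rw [hφ]
  exact congrArg (fun f => (show Module.Dual A _ from f.hom l)
    ((underlyingComplex.obj (E.obj n).obj).homologyπ (-i) x)) h
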